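/- Let $\Sigma$ be a finite alphabet with $q\ge 2$ symbols. Let $\mathcal F=\{a_1,\dots,a_s\}$ be a finite collection of words over $\Sigma$ of length at least $2$ which is reduced (no word in it is a subword of another one), and let $\Sigma_{\mathcal F}\subseteq\Sigma^{\mathbb N}$ be the set of one-sided sequences in which no word of $\mathcal F$ occurs. A word is allowed if it is a subword of some sequence in $\Sigma_{\mathcal F}$; $\mathcal L_n$ is the set of allowed words of length $n$. Assume that every symbol is allowed. Let $\mathcal R=\{r_1,\dots,r_\ell\}$ be a reduced collection of allowed words, with assigned multiplicities $m_1,\dots,m_\ell\in\mathbb Z_{\ge 2}$. Let $\mathcal F\cup\mathcal R\neq\emptyset$, let $p\ge 2$ be the length of the longest word in $\mathcal F\cup\mathcal R$, and assume that all words in $\mathcal R$ have length $p$. For an allowed word $w$ put $m(w)=\prod_i m_i^{n(w;r_i)}$, where $n(w;r_i)$ is the number of occurrences of $r_i$ as a subword of $w$, and for an allowed word $v=v_1\cdots v_n$ put $k(v)=m(v)/m(v_2\cdots v_n)$. Let $A$ be the matrix indexed by $\mathcal L_{p-1}$ with $A_{XY}=k(X*Y)$ if $x_2\cdots x_{p-1}=y_1\cdots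 y_{p-2}$ and $X*Y:=x_1\cdots x_{p-1}y_{p-1}\in\mathcal L_p$, and $A_{XY}=0$ otherwise. (Since all words of $\mathcal R$ have length $p$, here $k(X*Y)=m(X*Y)$.) Assume that $A$ is irreducible, that is, for all $X,Y$ there is $n\ge 1$ with $(A^n)_{XY}>0$, and let $\theta$ be its Perron root (its spectral radius). For words $u,v$ let $(u,v)_z=\sum_{i=1}^{|u|}c_i z^{|u|-i}$, where $c_i=1$ if the suffix of $u$ starting at its $i$-th symbol and the word $v$ agree on their overlap (one is a prefix of the other), and $c_i=0$ otherwise. Let $w_i=r_i$ for $1\le i\le\ell$ and $w_{\ell+j}=a_j$ for $1\le j\le s$. Let $D(z)$ be the diagonal matrix with entries $D_{ii}(z)=z(1-\tfrac1{m_i})$ for $1\le i\le\ell$ and $D_{ii}(z)=-z$ for $\ell<i\le\ell+s$; let $$P(z)_{ij}=D_{jj}(z)\,(w_j,w_i)_z-\varepsilon_{ij}\,z^{|w_i|},\qquad \varepsilon_{ij}=\begin{cases}1,& i=j\le\ell\\0,&\text{otherwise,}\end{cases}$$ and $Q(z)=D(z)^{-1}P(z)^{T}D(z)$. Let $R_i(z)$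 and $S_i(z)$ be the $i$-th row sums of $P(z)^{-1}$ and $Q(z)^{-1}$. For $X\in\mathcal L_{p-1}$ define $$U_X=1-\theta\sum_{i=1}^{\ell}\Bigl(1-\frac1{m_i}\Bigr)R_i(\theta)(\tilde r_i,X)_\theta+\theta\sum_{j=1}^{s}R_{\ell+j}(\theta)(\tilde a_j,X)_\theta,$$ $$V_X=1-\theta\sum_{i=1}^{\ell}\Bigl(1-\frac1{m_i}\Bigr)S_i(\theta)(X,r_i)_\theta+\theta\sum_{j=1}^{s}S_{\ell+j}(\theta)(X,a_j)_\theta,$$ where $\tilde w$ is $w$ with its first symbol removed. Then $P(\theta)$ and $Q(\theta)$ are invertible, so that $R_i(\theta)$ and $S_i(\theta)$ exist, and $U=(U_X)_{X\in\mathcal L_{p-1}}$ and $V=(V_X)_{X\in\mathcal L_{p-1}}$ are respectively left and right Perron eigenvectors of $A$: all their entries are positive, $U^{T}A=\theta U^{T}$ and $AV=\theta V$. -/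

import Mathlib

namespace RepeatedShift

/-- The block `x k, x (k+1), …, x (k+n-1)` of the one-sided sequence `x`. -/
def block {α : Type*} (x : ℕ → α) (k n : ℕ) : List α :=
  List.ofFn fun i : Fin n => x (k + i)

/-- The subshift of finite type: one-sided sequences in which no forbidden word `a i` occurs. -/
def subshift {α ι : Type*} (a : ι → List α) : Set (ℕ → α) :=
  {x | ∀ i k, block x k (a i).length ≠ a i}

/-- The allowed words of length `n`: the blocks of length `n` of points of the subshift. -/
def language {α ι : Type*} (a : ι → List α) (n : ℕ) : Set (List α) :=
  {w | w.length = n ∧ ∃ x ∈ subshift a, ∃ k, block x k n = w}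

/-- A word is allowed if it is a subword of some point of the subshift. -/
def IsAllowed {α ι : Type*} (a : ι → List α) (w : List α) : Prop :=
  w ∈ language a w.length

/-- A collection of words is reduced if no member is a subword of another one. -/
def IsReduced {α ι : Type*} (w : ι → List α) : Prop :=
  ∀ i j, i ≠ j → ¬ w i <:+: w j

theorem language_finite {α ι : Type*} [Finite α] (a : ι → List α) (n : ℕ) :
    (language a n).Finite :=
  (List.finite_length_eq α n).subset fun _ hw => hw.1

noncomputable instance {α ι : Type*} [Finite α] (a : ι → List α) (n : ℕ) :
    Fintype (language a n) :=
  (language_finite a n).fintype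

/-- The number of positions at which the (nonempty) word `r` occurs as a subword of `w`. -/
def occurrences {α : Type*} [DecidableEq α] (w r : List α) : ℕ :=
  ((Finset.range w.length).filter fun i => r <+: w.drop i).card

open Classical in
/-- The multiplicity of a word, for the forbidden words `a` and the repeated words `r j` with
assigned multiplicities `m j`. -/
noncomputable def multiplicity {α ι κ : Type*} [Fintype κ] [DecidableEq α]
    (a : ι → List α) (r : κ → List α) (m : κ → ℕ) (w : List α) : ℕ :=
  if IsAllowed a w then ∏ j, m j ^ occurrences w (r j) else 0

/-- `k(v) = m(v) / m(v₂ ⋯ vₙ)`. For an allowed word `v` this is an exact division by a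
nonzero number, as every occurrence in the tail of `v` is an occurrence in `v`. -/
noncomputable def relMultiplicity {α ι κ : Type*} [Fintype κ] [DecidableEq α]
    (a : ι → List α) (r : κ → List α) (m : κ → ℕ) (v : List α) : ℕ :=
  multiplicity a r m v / multiplicity a r m v.tail

/-- `X * Y`: the word `X` followed by the last symbol of `Y`. -/
def star {α : Type*} (X Y : List α) : List α :=
  X ++ Y.drop (Y.length - 1)

open Classical in
/-- The adjacency matrix associated with the forbidden words `a` and the repeated words `r`
of multiplicities `m`; `X * Y` is defined when `X.tail = Y.dropLast`. -/
noncomputable def adjacency {α ι κ : Type*} [Fintype κ] [DecidableEq α]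
    (a : ι → List α) (r : κ → List α) (m : κ → ℕ) (p : ℕ) :
    Matrix (language a (p - 1)) (language a (p - 1)) ℝ :=
  Matrix.of fun X Y =>
    if (X : List α).tail = (Y : List α).dropLast ∧ star (X : List α) Y ∈ language a p then
      (relMultiplicity a r m (star (X : List α) Y) : ℝ)
    else 0

/-- The Perron root of a nonnegative real matrix: its spectral radius, the largest modulus of
a complex eigenvalue. -/
noncomputable def perronRoot {n : Type*} [Fintype n] [DecidableEq n] (A : Matrix n n ℝ) : ℝ :=
  (spectralRadius ℂ (A.map (fun t : ℝ => (t : ℂ)))).toReal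

/-- The correlation polynomial `(u, v)_z = ∑ᵢ cᵢ z ^ (|u| - i)`, `1 ≤ i ≤ |u|`. With indices
shifted to start at `0`, the bit at `i` is `1` when the suffix of `u` starting at `i` and the word
`v` agree on their overlap, i.e. when one of them is a prefix of the other. -/
def correlation {α : Type*} [DecidableEq α] (u v : List α) (z : ℝ) : ℝ :=
  ∑ i ∈ Finset.range u.length,
    if u.drop i <+: v ∨ v <+: u.drop i then z ^ (u.length - 1 - i) else 0

section Matrices

variable {α : Type*} [DecidableEq α] {s ℓ : ℕ}

/-- The matrix `P(z)`; the indices `inl` stand for repeated words, `inr` for forbidden words. -/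
noncomputable def matP (a : Fin s → List α) (r : Fin ℓ → List α) (m : Fin ℓ → ℕ) (z : ℝ) :
    Matrix (Fin ℓ ⊕ Fin s) (Fin ℓ ⊕ Fin s) ℝ :=
  Matrix.fromBlocks
    (Matrix.of fun i j => z * (1 - 1 / (m j : ℝ)) * correlation (r j) (r i) z
      - if i = j then z ^ (r j).length else 0)
    (Matrix.of fun i j => -z * correlation (a j) (r i) z)
    (Matrix.of fun i j => z * (1 - 1 / (m j : ℝ)) * correlation (r j) (a i) z)
    (Matrix.of fun i j => -z * correlation (a j) (a i) z)

/-- The diagonal matrix `D(z)`. -/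
noncomputable def matD (s : ℕ) (m : Fin ℓ → ℕ) (z : ℝ) :
    Matrix (Fin ℓ ⊕ Fin s) (Fin ℓ ⊕ Fin s) ℝ :=
  Matrix.diagonal (Sum.elim (fun i => z * (1 - 1 / (m i : ℝ))) (fun _ => -z))

/-- The matrix `Q(z) = D(z)⁻¹ P(z)ᵀ D(z)`. -/
noncomputable def matQ (a : Fin s → List α) (r : Fin ℓ → List α) (m : Fin ℓ → ℕ) (z : ℝ) :
    Matrix (Fin ℓ ⊕ Fin s) (Fin ℓ ⊕ Fin s) ℝ :=
  (matD s m z)⁻¹ * (matP a r m z).transpose * matD s m z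

/-- `R i` is the sum of row `i` of `P(z)⁻¹`. -/
noncomputable def rowR (a : Fin s → List α) (r : Fin ℓ → List α) (m : Fin ℓ → ℕ) (z : ℝ)
    (i : Fin ℓ ⊕ Fin s) : ℝ :=
  ∑ j, (matP a r m z)⁻¹ i j

/-- `S i` is the sum of row `i` of `Q(z)⁻¹`. -/
noncomputable def rowS (a : Fin s → List α) (r : Fin ℓ → List α) (m : Fin ℓ → ℕ) (z : ℝ)
    (i : Fin ℓ ⊕ Fin s) : ℝ :=
  ∑ j, (matQ a r m z)⁻¹ i j

/-- The vector `U`, evaluated at `z`; `w.tail` is `w` without its first symbol. -/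
noncomputable def vecU (a : Fin s → List α) (r : Fin ℓ → List α) (m : Fin ℓ → ℕ) (z : ℝ)
    (X : List α) : ℝ :=
  1 - z * ∑ i, (1 - 1 / (m i : ℝ)) * rowR a r m z (Sum.inl i) * correlation (r i).tail X z
    + z * ∑ j, rowR a r m z (Sum.inr j) * correlation (a j).tail X z

/-- The vector `V`, evaluated at `z`. -/
noncomputable def vecV (a : Fin s → List α) (r : Fin ℓ → List α) (m : Fin ℓ → ℕ) (z : ℝ)
    (X : List α) : ℝ :=
  1 - z * ∑ i, (1 - 1 / (m i : ℝ)) * rowS a r m z (Sum.inl i) * correlation X (r i) z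
    + z * ∑ j, rowS a r m z (Sum.inr j) * correlation X (a j) z

end Matrices

end RepeatedShift

/-! Given coefficients c, put φ(X) = κ - ∑ⱼ (D(z)c)ⱼ (X, wⱼ)_z for every word X, of any length and
allowed or not. If no wⱼ occurs in X, then ∑_y (Xy, wⱼ)_z = z (X, wⱼ)_z + 1, so ∑_y φ(Xy) = z φ(X) +
δ with a constant δ, the `defect`. The system Q(z)c = κ1 yields φ(aⱼ) = 0 and φ(rᵢ) = mᵢ φ(r̃ᵢ).
Hence φ(Xy) is the weight of Xy times φ of its tail when |X| = p - 1, and φ is a right eigenvector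
up to δ (`IsSystem.sum_weight_mul_pot`). The system P(z)c = κ1 is the same one for the reversed
words, and gives left eigenvectors up to δ (`IsSystem.vecMul_potRev_adjacency`).

At z = θ, pairing the left relation with a positive right Perron eigenvector forces δ = 0
(`IsSystem.defect_eq_zero`). By Perron–Frobenius, φ is then zero, positive or negative on all
allowed words of length p - 1. The weak sign spreads to the other words avoiding the aⱼ and, through
z φ(X) = ∑_y φ(Xy), down to the empty word, where φ is κ (`IsSystem.pot_sign`). So κ = 0 forces φ =
0 and c = 0, which makes P(θ) invertible, and κ = 1 makes U positive.

For V, the defect equals that of U by transposition (`IsSystem.sum_coef_rowR_eq`). Moreover φ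
vanishes on words that avoid the aⱼ without being allowed, since these cannot be continued forever
(`IsSystem.pot_eq_zero_of_not_mem`), so restricting to allowed words loses nothing. -/

namespace RepeatedShift

/-! ### Perron–Frobenius theory for irreducible nonnegative matrices. -/

section Perron

variable {n : Type*} [Fintype n]

/-- The compact set of Collatz–Wielandt pairs attains its largest first component. -/
theorem exists_max_collatzWielandt [DecidableEq n] [Nonempty n] {A : Matrix n n ℝ}
    (hA : ∀ i j, 0 ≤ A i j) :
    ∃ (t : ℝ) (x : n → ℝ), 0 ≤ t ∧ x ∈ stdSimplex ℝ n ∧ (∀ i, t * x i ≤ A.mulVec x i) ∧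
      ∀ (t' : ℝ) (y : n → ℝ), 0 ≤ t' → y ∈ stdSimplex ℝ n →
        (∀ i, t' * y i ≤ A.mulVec y i) → t' ≤ t := by
  set S : Set (ℝ × (n → ℝ)) :=
    {q | 0 ≤ q.1 ∧ q.2 ∈ stdSimplex ℝ n ∧ ∀ i, q.1 * q.2 i ≤ A.mulVec q.2 i} with hS
  have hclosed : IsClosed S := by
    have h1 : IsClosed {q : ℝ × (n → ℝ) | 0 ≤ q.1} :=
      isClosed_le continuous_const continuous_fst
    have h2 : IsClosed {q : ℝ × (n → ℝ) | q.2 ∈ stdSimplex ℝ n} :=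
      (isClosed_stdSimplex ℝ n).preimage continuous_snd
    have h3 : IsClosed {q : ℝ × (n → ℝ) | ∀ i, q.1 * q.2 i ≤ A.mulVec q.2 i} := by
      simp only [Set.ofPred_forall]
      refine isClosed_iInter fun i => isClosed_le (by fun_prop) ?_
      simp only [Matrix.mulVec, dotProduct]
      fun_prop
    exact h1.inter (h2.inter h3)
  have hsub : S ⊆ Set.Icc 0 (∑ i, ∑ j, A i j) ×ˢ stdSimplex ℝ n := by
    rintro ⟨t, x⟩ ⟨ht, hx, hle⟩
    refine ⟨⟨ht, ?_⟩, hx⟩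
    have h1 : ∑ i, t * x i = t := by rw [← Finset.mul_sum, hx.2, mul_one]
    have hx1 : ∀ j, x j ≤ 1 := fun j => by
      rw [← hx.2]
      exact Finset.single_le_sum (fun k _ => hx.1 k) (Finset.mem_univ j)
    calc t = ∑ i, t * x i := h1.symm
      _ ≤ ∑ i, A.mulVec x i := Finset.sum_le_sum fun i _ => hle i
      _ ≤ ∑ i, ∑ j, A i j := Finset.sum_le_sum fun i _ => Finset.sum_le_sum fun j _ =>
          mul_le_of_le_one_right (hA i j) (hx1 j)
  have hcomp : IsCompact S :=
    (isCompact_Icc.prod (isCompact_stdSimplex ℝ n)).of_isClosed_subset hclosed hsub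
  have hne : S.Nonempty := by
    obtain ⟨i⟩ := ‹Nonempty n›
    have hi := single_mem_stdSimplex ℝ i
    refine ⟨(0, Pi.single i 1), le_rfl, hi, fun k => ?_⟩
    simp only [zero_mul]
    exact Finset.sum_nonneg fun j _ => mul_nonneg (hA k j) (hi.1 j)
  obtain ⟨⟨t, x⟩, ⟨ht, hx, hle⟩, hmax⟩ := hcomp.exists_isMaxOn hne continuous_fst.continuousOn
  exact ⟨t, x, ht, hx, hle, fun t' y h1 h2 h3 => hmax (show (t', y) ∈ S from ⟨h1, h2, h3⟩)⟩

/-- A matrix with positive entries takes nonzero nonnegative vectors to positive ones. -/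
theorem mulVec_pos_of_entries_pos {B : Matrix n n ℝ} (hB : ∀ i j, 0 < B i j) {x : n → ℝ}
    (hx : ∀ i, 0 ≤ x i) (hx0 : x ≠ 0) (i : n) : 0 < B.mulVec x i := by
  obtain ⟨j, hj⟩ := Function.ne_iff.1 hx0
  exact Finset.sum_pos' (fun k _ => mul_nonneg (hB i k).le (hx k))
    ⟨j, Finset.mem_univ j, mul_pos (hB i j) ((hx j).lt_of_ne' hj)⟩

/-- A nonnegative irreducible matrix has a sum of powers with positive entries. -/
theorem exists_pow_sum_pos [DecidableEq n] {A : Matrix n n ℝ} (hirr : A.IsIrreducible) :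
    ∃ k : n → n → ℕ, (∀ i j, 0 < k i j) ∧ ∀ i j, 0 < (∑ a, ∑ b, A ^ k a b) i j := by
  choose k hk hpos using (Matrix.isIrreducible_iff_exists_pow_pos hirr.nonneg).1 hirr
  refine ⟨k, hk, fun i j => ?_⟩
  simp only [Matrix.sum_apply]
  have hnn := fun a b : n => Matrix.pow_apply_nonneg hirr.nonneg (k a b) i j
  exact Finset.sum_pos' (fun a _ => Finset.sum_nonneg fun b _ => hnn a b)
    ⟨i, Finset.mem_univ i, Finset.sum_pos' (fun b _ => hnn i b) ⟨j, Finset.mem_univ j, hpos i j⟩⟩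

theorem pow_mulVec_eq [DecidableEq n] {A : Matrix n n ℝ} {x : n → ℝ} {t : ℝ}
    (h : A.mulVec x = t • x) (k : ℕ) :
    (A ^ k).mulVec x = t ^ k • x := by
  induction k with
  | zero => simp
  | succ k ih =>
    rw [pow_succ, ← Matrix.mulVec_mulVec, h, Matrix.mulVec_smul, ih, smul_smul, pow_succ, mul_comm]

/-- A nonnegative nonzero eigenvector of an irreducible matrix is positive, with positive
eigenvalue. -/
theorem pos_of_nonneg_eigenvector [DecidableEq n] {A : Matrix n n ℝ} (hirr : A.IsIrreducible)
    {x : n → ℝ} {t : ℝ}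
    (ht : 0 ≤ t) (hx : ∀ i, 0 ≤ x i) (hx0 : x ≠ 0) (h : A.mulVec x = t • x) :
    0 < t ∧ ∀ i, 0 < x i := by
  obtain ⟨k, hk, hB⟩ := exists_pow_sum_pos hirr
  have hBx : (∑ a, ∑ b, A ^ k a b).mulVec x = (∑ a, ∑ b, t ^ k a b) • x := by
    simp only [Matrix.sum_mulVec, pow_mulVec_eq h, Finset.sum_smul]
  have hpos : ∀ i, 0 < (∑ a, ∑ b, t ^ k a b) * x i := fun i => by
    have := mulVec_pos_of_entries_pos hB hx hx0 i
    rwa [hBx] at this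
  refine ⟨ht.lt_of_ne' ?_, fun i => (hx i).lt_of_ne' ?_⟩
  · rintro rfl
    obtain ⟨i, -⟩ := Function.ne_iff.1 hx0
    have := hpos i
    simp [zero_pow (hk _ _).ne'] at this
  · intro h0
    have := hpos i
    simp [h0] at this

/-- Existence in the Perron–Frobenius theorem. -/
theorem exists_pos_eigenvector [DecidableEq n] [Nonempty n] {A : Matrix n n ℝ}
    (hirr : A.IsIrreducible) :
    ∃ (t : ℝ) (v : n → ℝ), 0 < t ∧ (∀ i, 0 < v i) ∧ A.mulVec v = t • v := by
  obtain ⟨t, x, ht, hx, hle, hmax⟩ := exists_max_collatzWielandt hirr.nonneg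
  obtain ⟨k, hk, hB⟩ := exists_pow_sum_pos hirr
  set B : Matrix n n ℝ := ∑ a, ∑ b, A ^ k a b with hBdef
  have hcomm : A * B = B * A := by
    simp only [hBdef, Finset.mul_sum, Finset.sum_mul]
    simp only [← pow_succ, ← pow_succ']
  have hx0 : x ≠ 0 := by
    rintro rfl
    simpa using hx.2
  suffices heq : A.mulVec x = t • x by
    obtain ⟨h1, h2⟩ := pos_of_nonneg_eigenvector hirr ht hx.1 hx0 heq
    exact ⟨t, x, h1, h2, heq⟩
  -- If `A x ≠ t x`, the positive matrix `B`, which commutes with `A`, makes the inequality strict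
  -- for `z = B x`. Then `t` can be raised by the least relative surplus `ε`, against maximality.
  by_contra hne
  have hy : ∀ i, 0 < B.mulVec (A.mulVec x - t • x) i :=
    mulVec_pos_of_entries_pos hB (fun i => by simpa using hle i) (sub_ne_zero.2 hne)
  have hz : ∀ i, 0 < B.mulVec x i := mulVec_pos_of_entries_pos hB hx.1 hx0
  set z := B.mulVec x with hzdef
  have hAz : B.mulVec (A.mulVec x - t • x) = A.mulVec z - t • z := by
    rw [Matrix.mulVec_sub, Matrix.mulVec_smul, hzdef, Matrix.mulVec_mulVec, Matrix.mulVec_mulVec,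
      hcomm]
  obtain ⟨i₀, -, hi₀⟩ := Finset.exists_min_image Finset.univ
    (fun i => (A.mulVec z i - t * z i) / z i) Finset.univ_nonempty
  set ε := (A.mulVec z i₀ - t * z i₀) / z i₀ with hε
  have hy' : ∀ i, 0 < A.mulVec z i - t * z i := fun i => by
    have := hy i
    rwa [hAz] at this
  have hεpos : 0 < ε := div_pos (hy' i₀) (hz i₀)
  have hsum : 0 < ∑ i, z i := Finset.sum_pos (fun i _ => hz i) Finset.univ_nonempty
  have := hmax (t + ε) ((∑ i, z i)⁻¹ • z) (by positivity)
    ⟨fun i => mul_nonneg (inv_nonneg.2 hsum.le) (hz i).le, by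
      simp only [Pi.smul_apply, smul_eq_mul, ← Finset.mul_sum]
      exact inv_mul_cancel₀ hsum.ne'⟩ (fun i => by
      rw [Matrix.mulVec_smul]
      simp only [Pi.smul_apply, smul_eq_mul]
      have h1 := (le_div_iff₀ (hz i)).1 (hi₀ i (Finset.mem_univ i))
      have h2 : (t + ε) * z i ≤ A.mulVec z i := by linarith
      calc (t + ε) * ((∑ i, z i)⁻¹ * z i) = (∑ i, z i)⁻¹ * ((t + ε) * z i) := by ring
        _ ≤ _ := mul_le_mul_of_nonneg_left h2 (inv_nonneg.2 hsum.le))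
  linarith

/-- A complex eigenvalue of a nonnegative matrix is bounded by any eigenvalue that has a
positive eigenvector. -/
theorem norm_le_of_pos_eigenvector {A : Matrix n n ℝ} (hA : ∀ i j, 0 ≤ A i j) {v : n → ℝ} {t : ℝ}
    (hv : ∀ i, 0 < v i) (h : A.mulVec v = t • v) {μ : ℂ} {x : n → ℂ} (hx : x ≠ 0)
    (hμ : (A.map (fun s : ℝ => (s : ℂ))).mulVec x = μ • x) : ‖μ‖ ≤ t := by
  obtain ⟨j, hj⟩ := Function.ne_iff.1 hx
  -- The eigenvalue equation is read at the index where `|x|` is largest relative to `v`.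
  obtain ⟨i, -, hi⟩ := Finset.exists_max_image Finset.univ
    (fun i => ‖x i‖ / v i) ⟨j, Finset.mem_univ j⟩
  set c := ‖x i‖ / v i with hc
  have hxi : ‖x i‖ = c * v i := by rw [hc, div_mul_cancel₀ _ (hv i).ne']
  have hcpos : 0 < c := (div_pos (norm_pos_iff.2 hj) (hv j)).trans_le (hi j (Finset.mem_univ j))
  have hle : ∀ k, ‖x k‖ ≤ c * v k := fun k => (div_le_iff₀ (hv k)).1 (hi k (Finset.mem_univ k))
  have hvi : ∑ k, A i k * v k = t * v i := congrFun h i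
  have h1 : ‖μ‖ * (c * v i) ≤ t * (c * v i) := by
    calc ‖μ‖ * (c * v i) = ‖∑ k, (A i k : ℂ) * x k‖ := by
          rw [← hxi, ← norm_mul]
          exact congrArg norm (congrFun hμ i).symm
      _ ≤ ∑ k, ‖(A i k : ℂ) * x k‖ := norm_sum_le _ _
      _ ≤ ∑ k, A i k * (c * v k) := Finset.sum_le_sum fun k _ => by
          rw [norm_mul, Complex.norm_real, Real.norm_of_nonneg (hA i k)]
          exact mul_le_mul_of_nonneg_left (hle k) (hA i k)
      _ = c * ∑ k, A i k * v k := by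
          rw [Finset.mul_sum]
          exact Finset.sum_congr rfl fun k _ => by ring
      _ = t * (c * v i) := by rw [hvi]; ring
  exact le_of_mul_le_mul_right h1 (mul_pos hcpos (hv i))

theorem mem_spectrum_iff_exists_mulVec [DecidableEq n] {M : Matrix n n ℂ} {μ : ℂ} :
    μ ∈ spectrum ℂ M ↔ ∃ x ≠ 0, M.mulVec x = μ • x := by
  rw [← Matrix.spectrum_toLin', ← Module.End.hasEigenvalue_iff_mem_spectrum]
  constructor
  · intro h
    obtain ⟨x, hx⟩ := h.exists_hasEigenvector
    exact ⟨x, hx.2, by simpa using hx.apply_eq_smul⟩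
  · rintro ⟨x, hx, h⟩
    exact Module.End.hasEigenvalue_of_hasEigenvector
      (Module.End.hasEigenvector_iff.2 ⟨Module.End.mem_eigenspace_iff.2 (by simpa using h), hx⟩)

/-- The spectral radius of a nonnegative matrix is the eigenvalue of any positive eigenvector. -/
theorem perronRoot_eq_of_pos_eigenvector [DecidableEq n] [Nonempty n] {A : Matrix n n ℝ}
    (hA : ∀ i j, 0 ≤ A i j)
    {v : n → ℝ} {t : ℝ} (ht : 0 ≤ t) (hv : ∀ i, 0 < v i) (h : A.mulVec v = t • v) :
    perronRoot A = t := by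
  have hrad : spectralRadius ℂ (A.map (fun s : ℝ => (s : ℂ))) = ENNReal.ofReal t := by
    apply le_antisymm
    · refine iSup₂_le fun μ hμ => ?_
      obtain ⟨x, hx, hμx⟩ := mem_spectrum_iff_exists_mulVec.1 hμ
      rw [← enorm_eq_nnnorm, ← ofReal_norm]
      exact ENNReal.ofReal_le_ofReal (norm_le_of_pos_eigenvector hA hv h hx hμx)
    · have hmem : (t : ℂ) ∈ spectrum ℂ (A.map (fun s : ℝ => (s : ℂ))) := by
        refine mem_spectrum_iff_exists_mulVec.2 ⟨fun i => (v i : ℂ), ?_, ?_⟩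
        · obtain ⟨i⟩ := ‹Nonempty n›
          exact Function.ne_iff.2 ⟨i, by simpa using (hv i).ne'⟩
        · ext i
          have := congrFun h i
          simp only [Matrix.mulVec, dotProduct, Matrix.map_apply, Pi.smul_apply,
            smul_eq_mul] at this ⊢
          exact_mod_cast this
      have hle := le_iSup₂ (f := fun (k : ℂ)
        (_ : k ∈ spectrum ℂ (A.map (fun s : ℝ => (s : ℂ)))) => (‖k‖₊ : ENNReal)) (t : ℂ) hmem
      refine le_trans (le_of_eq ?_) hle
      rw [← enorm_eq_nnnorm, ← ofReal_norm, Complex.norm_real, Real.norm_of_nonneg ht]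
  rw [perronRoot, hrad, ENNReal.toReal_ofReal ht]

/-- A left vector fixed up to a constant vector is fixed, if there is a positive right one. -/
theorem const_eq_zero_of_vecMul [Nonempty n] {A : Matrix n n ℝ} {v w : n → ℝ} {t κ : ℝ}
    (hv : ∀ i, 0 < v i) (h : A.mulVec v = t • v)
    (hw : ∀ j, Matrix.vecMul w A j = t * w j + κ) : κ = 0 := by
  have h1 : Matrix.vecMul w A ⬝ᵥ v = w ⬝ᵥ A.mulVec v := (Matrix.dotProduct_mulVec w A v).symm
  rw [h] at h1
  simp only [dotProduct, hw, Pi.smul_apply, smul_eq_mul, add_mul, Finset.sum_add_distrib,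
    ← Finset.mul_sum] at h1
  have h2 : ∑ i, t * w i * v i = ∑ i, w i * (t * v i) := Finset.sum_congr rfl fun i _ => by ring
  have h3 : κ * ∑ i, v i = 0 := by linarith
  exact (mul_eq_zero.1 h3).resolve_right
    (Finset.sum_pos (fun i _ => hv i) Finset.univ_nonempty).ne'

/-- Eigenvectors for the Perron root have a constant strict sign. -/
theorem eigenvector_trichotomy [DecidableEq n] {A : Matrix n n ℝ} (hirr : A.IsIrreducible)
    {v : n → ℝ}
    {t : ℝ} (ht : 0 < t) (hv : ∀ i, 0 < v i) (h : A.vecMul v = t • v) {w : n → ℝ}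
    (hw : A.mulVec w = t • w) : w = 0 ∨ (∀ i, 0 < w i) ∨ ∀ i, w i < 0 := by
  have hle : ∀ i, t * |w i| ≤ A.mulVec (fun j => |w j|) i := fun i => by
    have := congrFun hw i
    simp only [Matrix.mulVec, dotProduct, Pi.smul_apply, smul_eq_mul] at this ⊢
    rw [← abs_of_pos ht, ← abs_mul, ← this]
    refine (Finset.abs_sum_le_sum_abs _ _).trans (le_of_eq (Finset.sum_congr rfl fun j _ => ?_))
    rw [abs_mul, abs_of_nonneg (hirr.nonneg i j)]
  -- Pairing `A|w| - t|w| ≥ 0` with the positive left eigenvector gives 0, so every entry vanishes.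
  have habs : A.mulVec (fun j => |w j|) = t • fun j => |w j| := by
    have h1 : v ⬝ᵥ A.mulVec (fun j => |w j|) = Matrix.vecMul v A ⬝ᵥ fun j => |w j| :=
      Matrix.dotProduct_mulVec _ _ _
    rw [h] at h1
    have h2 : ∑ i, v i * (A.mulVec (fun j => |w j|) i - t * |w i|) = 0 := by
      simp only [dotProduct, Pi.smul_apply, smul_eq_mul] at h1
      simp only [mul_sub, Finset.sum_sub_distrib, h1]
      exact sub_eq_zero.2 (Finset.sum_congr rfl fun i _ => by ring)
    have h3 := (Finset.sum_eq_zero_iff_of_nonneg fun i _ =>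
      mul_nonneg (hv i).le (sub_nonneg.2 (hle i))).1 h2
    ext i
    have := (mul_eq_zero.1 (h3 i (Finset.mem_univ i))).resolve_left (hv i).ne'
    simpa using sub_eq_zero.1 this
  -- Twice the positive part of `w` is again a nonnegative eigenvector, hence zero or strictly
  -- positive; these are the two signs.
  have hplus : A.mulVec (fun j => |w j| + w j) = t • fun j => |w j| + w j := by
    change A.mulVec ((fun j => |w j|) + w) = t • ((fun j => |w j|) + w)
    rw [Matrix.mulVec_add, habs, hw, smul_add]
  by_cases hw0 : w = 0
  · exact Or.inl hw0
  refine Or.inr ?_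
  have hne : (fun j => |w j|) ≠ 0 := fun hz => hw0 (funext fun i => abs_eq_zero.1 (congrFun hz i))
  have hpos := (pos_of_nonneg_eigenvector hirr ht.le (fun i => abs_nonneg (w i)) hne habs).2
  by_cases hp0 : (fun j => |w j| + w j) = 0
  · right
    intro i
    have h1 : |w i| + w i = 0 := congrFun hp0 i
    linarith [hpos i]
  · left
    intro i
    have h1 := (pos_of_nonneg_eigenvector hirr ht.le
      (fun i => by linarith [neg_abs_le (w i)]) hp0 hplus).2 i
    by_contra hneg
    rw [abs_of_nonpos (not_lt.1 hneg)] at h1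
    linarith

end Perron

/-! ### Correlation polynomials: extension by a symbol, and reversal. -/

section Correlation

theorem prefix_concat_agree_iff {α : Type*} {W v : List α} (hv : ¬ v <:+: W) (y : α) :
    (W ++ [y] <+: v ∨ v <+: W ++ [y]) ↔ W ++ [y] <+: v := by
  refine ⟨fun h => h.elim id fun h => ?_, Or.inl⟩
  rcases List.prefix_concat_iff.1 h with h | h
  · exact h ▸ List.prefix_rfl
  · exact absurd h.isInfix hv

theorem prefix_dropLast_of_ne {α : Type*} {u v : List α} (h : u <+: v) (hne : u ≠ v)
    : u <+: v.dropLast := by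
  rcases List.eq_nil_or_concat v with rfl | ⟨v', y, rfl⟩
  · exact absurd (List.prefix_nil.1 h) hne
  · rw [List.concat_eq_append] at *
    rw [List.dropLast_concat]
    exact (List.prefix_concat_iff.1 h).resolve_left hne

variable {α : Type*} [DecidableEq α]

theorem correlation_nil (v : List α) (z : ℝ) : correlation [] v z = 0 := by
  simp [correlation]

theorem correlation_cons (x : α) (X v : List α) (z : ℝ) :
    correlation (x :: X) v z =
      (if x :: X <+: v ∨ v <+: x :: X then z ^ X.length else 0) + correlation X v z := by
  simp only [correlation, List.length_cons, Finset.sum_range_succ', List.drop_zero,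
    List.drop_succ_cons]
  rw [add_comm]
  congr 1
  refine Finset.sum_congr rfl fun i _ => ?_
  rw [show X.length + 1 - 1 - (i + 1) = X.length - 1 - i by omega]

/-- If `W` agrees with `v` it is a proper prefix of `v`, and exactly one symbol `y` continues it
along `v`. -/
theorem sum_agree_concat [Fintype α] {W v : List α} (hv : ¬ v <:+: W) (t : ℝ) :
    ∑ y, (if W ++ [y] <+: v ∨ v <+: W ++ [y] then t else 0) =
      if W <+: v ∨ v <+: W then t else 0 := by
  simp only [prefix_concat_agree_iff hv]
  by_cases hW : W <+: v
  · rw [if_pos (Or.inl hW)]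
    obtain ⟨u, rfl⟩ := hW
    cases u with
    | nil => exact absurd (by simp) hv
    | cons c u =>
      simp only [List.prefix_append_right_inj, List.cons_prefix_cons, List.nil_prefix, and_true]
      simp
  · have h1 : ¬ (W <+: v ∨ v <+: W) := not_or.2 ⟨hW, fun h => hv h.isInfix⟩
    rw [if_neg h1]
    exact Finset.sum_eq_zero fun y _ => if_neg fun h => hW ((List.prefix_append _ _).trans h)

/-- Each suffix of `X` keeps its correlation bit for a single `y`, while its power of `z` rises by
one. The extra 1 comes from the empty suffix, extended by the first symbol of `v`. -/
theorem sum_correlation_concat [Fintype α] {X v : List α} (hv : ¬ v <:+: X) (z : ℝ) :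
    ∑ y, correlation (X ++ [y]) v z = z * correlation X v z + 1 := by
  induction X with
  | nil =>
    simp only [List.nil_append, correlation_cons, correlation_nil, List.length_nil, pow_zero,
      add_zero, mul_zero, zero_add]
    have := sum_agree_concat (W := []) hv 1
    simpa using this
  | cons x X ih =>
    have hv' : ¬ v <:+: X := fun h => hv (List.infix_cons h)
    have := sum_agree_concat hv (z ^ (X.length + 1))
    simp only [List.cons_append] at this
    simp only [List.cons_append, correlation_cons, Finset.sum_add_distrib, ih hv',
      List.length_append, List.length_cons, List.length_nil, zero_add, this]
    split_ifs <;> ring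

/-- Correlation restricted to the overlaps by which neither word is exceeded. -/
def overlap (u v : List α) (z : ℝ) : ℝ :=
  ∑ k ∈ Finset.range (min u.length v.length),
    if u.drop (u.length - 1 - k) = v.take (k + 1) then z ^ k else 0

/-- The terms are indexed by overlap length `k + 1`. A bit at a suffix longer than `v` would place
`v` inside the longer word `u`, which `h` excludes. -/
theorem correlation_eq_overlap {u v : List α} (h : v <:+: u → u.length ≤ v.length) (z : ℝ) :
    correlation u v z = overlap u v z := by
  rw [correlation, overlap, ← Finset.sum_range_reflect]
  have hsub : Finset.range (min u.length v.length) ⊆ Finset.range u.length :=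
    Finset.range_subset_range.2 (min_le_left _ _)
  rw [← Finset.sum_subset hsub]
  · refine Finset.sum_congr rfl fun k hk => ?_
    have hk' := Finset.mem_range.1 hk
    have hku : k < u.length := by omega
    have hkv : k < v.length := by omega
    rw [show u.length - 1 - (u.length - 1 - k) = k by omega]
    have hlen : (u.drop (u.length - 1 - k)).length = k + 1 := by
      rw [List.length_drop]; omega
    refine if_congr ?_ rfl rfl
    constructor
    · rintro (h1 | h1)
      · rw [List.prefix_iff_eq_take.1 h1, hlen]
      · have : v.length = k + 1 := by have := h1.length_le; omega
        rw [← this, List.take_length]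
        exact (h1.eq_of_length (by omega)).symm
    · intro h1
      exact Or.inl (h1 ▸ List.take_prefix _ _)
  · intro k hk hk'
    simp only [Finset.mem_range] at hk hk'
    have hlen : (u.drop (u.length - 1 - k)).length = k + 1 := by
      rw [List.length_drop]; omega
    refine if_neg ?_
    rintro (h1 | h1)
    · have := h1.length_le; omega
    · have := h (h1.isInfix.trans (List.drop_suffix _ _).isInfix); omega

theorem overlap_reverse (u v : List α) (z : ℝ) :
    overlap v.reverse u.reverse z = overlap u v z := by
  rw [overlap, overlap, List.length_reverse, List.length_reverse, min_comm]
  refine Finset.sum_congr rfl fun k hk => ?_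
  have hk' := Finset.mem_range.1 hk
  refine if_congr ?_ rfl rfl
  rw [List.drop_reverse, List.take_reverse, List.reverse_inj,
    show v.length - (v.length - 1 - k) = k + 1 by omega,
    show u.length - (k + 1) = u.length - 1 - k by omega, eq_comm]

theorem correlation_reverse {u v : List α} (h : v <:+: u → u.length ≤ v.length)
    (h' : u <:+: v → v.length ≤ u.length) (z : ℝ) :
    correlation v.reverse u.reverse z = correlation u v z := by
  rw [correlation_eq_overlap h, ← overlap_reverse, correlation_eq_overlap]
  simpa using h'

theorem overlap_tail {u v : List α} (h : ¬ u <+: v) (z : ℝ) :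
    overlap u.tail v z = overlap u v z := by
  cases u with
  | nil => rfl
  | cons x u =>
    rw [List.tail_cons, overlap, overlap]
    have hcongr : ∀ k ∈ Finset.range (min u.length v.length),
        (if u.drop (u.length - 1 - k) = v.take (k + 1) then z ^ k else 0) =
        if (x :: u).drop ((x :: u).length - 1 - k) = v.take (k + 1) then z ^ k else 0 := by
      intro k hk
      have hk' := Finset.mem_range.1 hk
      rw [List.length_cons, show u.length + 1 - 1 - k = (u.length - 1 - k) + 1 by omega,
        List.drop_succ_cons]
    rw [Finset.sum_congr rfl hcongr, List.length_cons]
    rcases Nat.lt_or_ge u.length v.length with hlt | hge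
    · rw [min_eq_left hlt.le, min_eq_left (show u.length + 1 ≤ v.length from hlt),
        Finset.sum_range_succ, left_eq_add, if_neg]
      intro heq
      apply h
      simp only [Nat.add_sub_cancel, Nat.sub_self, List.drop_zero] at heq
      exact heq ▸ List.take_prefix _ _
    · rw [min_eq_right hge, min_eq_right (by omega)]

/-- This explains the truncated words in `U`: without its first symbol `u` is no longer than `v`, so
only genuine overlaps count, and these are symmetric under reversal. -/
theorem correlation_tail_eq_reverse {u v : List α} (hlen : u.length ≤ v.length + 1)
    (h : ¬ u <:+: v) (z : ℝ) :
    correlation u.tail v z = correlation v.reverse u.reverse z := by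
  rw [correlation_eq_overlap (u := u.tail), overlap_tail fun h' => h h'.isInfix, ← overlap_reverse,
    correlation_eq_overlap]
  · intro h'
    exact absurd (List.reverse_infix.1 h') h
  · intro _
    rw [List.length_tail]
    omega

end Correlation

/-! ### Potentials: a constant corrected by correlations. -/

section Potential

variable {α ι : Type*} [DecidableEq α] [Fintype ι]

/-- No word of the family occurs in `X`. -/
def Avoids {α ι : Type*} (w : ι → List α) (X : List α) : Prop :=
  ∀ j, ¬ w j <:+: X

theorem Avoids.of_infix {α ι : Type*} {w : ι → List α} {X Y : List α} (h : Avoids w Y)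
    (hXY : X <:+: Y) : Avoids w X :=
  fun j hj => h j (hj.trans hXY)

/-- A constant corrected by the correlations with the words `w j`, with coefficients `d j`. -/
def potential (w : ι → List α) (d : ι → ℝ) (κ z : ℝ) (X : List α) : ℝ :=
  κ - ∑ j, d j * correlation X (w j) z

theorem potential_nil (w : ι → List α) (d : ι → ℝ) (κ z : ℝ) : potential w d κ z [] = κ := by
  simp [potential, correlation_nil]

theorem potential_neg (w : ι → List α) (d : ι → ℝ) (κ z : ℝ) (X : List α) :
    potential w (-d) (-κ) z X = -potential w d κ z X := by
  simp only [potential, Pi.neg_apply, neg_mul, Finset.sum_neg_distrib]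
  ring

theorem potential_cons (w : ι → List α) (d : ι → ℝ) (κ z : ℝ) (x : α) (X : List α) :
    potential w d κ z (x :: X) = potential w d κ z X -
      ∑ j, if x :: X <+: w j ∨ w j <+: x :: X then d j * z ^ X.length else 0 := by
  simp only [potential, correlation_cons, mul_add, Finset.sum_add_distrib, mul_ite, mul_zero]
  ring

theorem potential_cons_of_not_agree {w : ι → List α} (d : ι → ℝ) (κ z : ℝ) {x : α} {X : List α}
    (h : ∀ j, ¬ (x :: X <+: w j ∨ w j <+: x :: X)) :
    potential w d κ z (x :: X) = potential w d κ z X := by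
  rw [potential_cons, sub_eq_self]
  exact Finset.sum_eq_zero fun j _ => if_neg (h j)

theorem sum_potential_concat [Fintype α] {w : ι → List α} (d : ι → ℝ) (κ z : ℝ) {X : List α}
    (hX : Avoids w X) :
    ∑ y, potential w d κ z (X ++ [y]) =
      z * potential w d κ z X + ((Fintype.card α - z) * κ - ∑ j, d j) := by
  simp only [potential, Finset.sum_sub_distrib, Finset.sum_const, Finset.card_univ, nsmul_eq_mul]
  rw [Finset.sum_comm]
  simp only [← Finset.mul_sum, sum_correlation_concat (hX _), mul_add, mul_one,
    Finset.sum_add_distrib, mul_left_comm _ z]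
  ring

/-- Prepending the first symbol adds one new correlation bit per word, and by reducedness only `w i`
itself agrees with all of `w i`. -/
theorem potential_word [DecidableEq ι] {w : ι → List α} (hred : ∀ i j, w i <:+: w j → i = j)
    (d : ι → ℝ) (κ z : ℝ) {i : ι} (hne : w i ≠ []) :
    potential w d κ z (w i) =
      potential w d κ z (w i).tail - d i * z ^ ((w i).length - 1) := by
  obtain ⟨x, X, hX⟩ := List.exists_cons_of_ne_nil hne
  have h := potential_cons w d κ z x X
  rw [← hX, Finset.sum_eq_single i] at h
  · rw [h, if_pos (Or.inl List.prefix_rfl), hX]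
    simp
  · intro j _ hj
    refine if_neg ?_
    rintro (h1 | h1)
    · exact hj (hred _ _ h1.isInfix).symm
    · exact hj (hred _ _ h1.isInfix)
  · simp

/-- The potential of a word ending in `w i` is that of `w i`, if nothing occurs earlier. -/
theorem potential_append_word {w : ι → List α} (hred : ∀ i j, w i <:+: w j → i = j)
    (d : ι → ℝ) (κ z : ℝ) (i : ι) (b : List α) (hb : Avoids w (b ++ w i).dropLast) :
    potential w d κ z (b ++ w i) = potential w d κ z (w i) := by
  induction b with
  | nil => rfl
  | cons x b ih =>
    -- A word covering the final `w i` must be `w i` by reducedness, but then it is too short to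
    -- cover `x :: b` as well.
    have key : ∀ j, w i <:+: w j → (x :: (b ++ w i)).length ≤ (w j).length → False := by
      intro j h1 h2
      obtain rfl := hred _ _ h1
      simp at h2
    have hsuff : w i <:+: x :: (b ++ w i) := ⟨x :: b, [], by simp⟩
    rw [List.cons_append, potential_cons_of_not_agree]
    · refine ih (hb.of_infix ?_)
      rcases List.eq_nil_or_concat (b ++ w i) with h | ⟨v', y, h⟩
      · simp [h]
      · simp only [List.cons_append, h, List.concat_eq_append, List.dropLast_concat]
        rw [← List.cons_append, List.dropLast_concat]
        exact List.infix_cons List.infix_rfl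
    · rintro j (h1 | h1)
      · exact key j (hsuff.trans h1.isInfix) h1.length_le
      · by_cases heq : w j = x :: (b ++ w i)
        · exact key j (heq ▸ hsuff) (by rw [heq])
        · exact hb j (prefix_dropLast_of_ne h1 heq).isInfix

end Potential

/-! ### Solutions of the linear system, their eigenvector relation and their sign. -/

section Engine

variable {α : Type*} {s ℓ : ℕ}

/-- The combinatorial hypotheses on the forbidden words `a` and the repeated words `r`. They are
invariant under reversal of all words. -/
structure IsSystem (a : Fin s → List α) (r : Fin ℓ → List α) (m : Fin ℓ → ℕ) (p : ℕ) :
    Prop where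
  two_le : 2 ≤ p
  ne_nil : ∀ j, a j ≠ []
  length_le : ∀ j, (a j).length ≤ p
  length_eq : ∀ i, (r i).length = p
  mult : ∀ i, 2 ≤ m i
  reduced : ∀ i j, Sum.elim r a i <:+: Sum.elim r a j → i = j

/-- The diagonal of `D(z)` times the vector `c`. -/
noncomputable def coef (m : Fin ℓ → ℕ) (z : ℝ) (c : Fin ℓ ⊕ Fin s → ℝ) : Fin ℓ ⊕ Fin s → ℝ :=
  Sum.elim (fun i => z * (1 - 1 / (m i : ℝ)) * c (Sum.inl i)) (fun j => -z * c (Sum.inr j))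

open Classical in
/-- The weight of a word of length `p`. -/
noncomputable def weight (a : Fin s → List α) (r : Fin ℓ → List α) (m : Fin ℓ → ℕ)
    (v : List α) : ℝ :=
  if Avoids a v then ∏ i, if v = r i then (m i : ℝ) else 1 else 0

/-- The constant by which the potential fails to be an eigenvector. -/
noncomputable def defect [Fintype α] (m : Fin ℓ → ℕ) (z κ : ℝ) (c : Fin ℓ ⊕ Fin s → ℝ) : ℝ :=
  (Fintype.card α - z) * κ - ∑ j, coef m z c j

variable {a : Fin s → List α} {r : Fin ℓ → List α} {m : Fin ℓ → ℕ} {p : ℕ} {z κ : ℝ}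
  {c : Fin ℓ ⊕ Fin s → ℝ}

theorem coef_neg (m : Fin ℓ → ℕ) (z : ℝ) (c : Fin ℓ ⊕ Fin s → ℝ) :
    coef m z (-c) = -coef m z c := by
  ext (i | j) <;> simp [coef]

theorem defect_neg [Fintype α] :
    defect (α := α) m z (-κ) (-c) = -defect (α := α) m z κ c := by
  simp only [defect, coef_neg, Pi.neg_apply, Finset.sum_neg_distrib]
  ring

theorem IsSystem.reverse (h : IsSystem a r m p) :
    IsSystem (fun j => (a j).reverse) (fun i => (r i).reverse) m p where
  two_le := h.two_le
  ne_nil j := by simpa using h.ne_nil j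
  length_le j := by simpa using h.length_le j
  length_eq i := by simpa using h.length_eq i
  mult := h.mult
  reduced := by
    have key : ∀ i, Sum.elim (fun i => (r i).reverse) (fun j => (a j).reverse) i =
        (Sum.elim r a i).reverse := by rintro (i | j) <;> rfl
    intro i j hij
    rw [key, key, List.reverse_infix] at hij
    exact h.reduced i j hij

theorem avoids_reverse_iff {X : List α} :
    Avoids (fun j => (a j).reverse) X.reverse ↔ Avoids a X := by
  simp only [Avoids, List.reverse_infix]

open Classical in
theorem weight_reverse (X : List α) :
    weight (fun j => (a j).reverse) (fun i => (r i).reverse) m X.reverse = weight a r m X := by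
  by_cases h : Avoids a X
  · rw [weight, weight, if_pos h, if_pos (avoids_reverse_iff.2 h)]
    exact Finset.prod_congr rfl fun i _ => if_congr List.reverse_inj rfl rfl
  · rw [weight, weight, if_neg h, if_neg (mt avoids_reverse_iff.1 h)]

theorem weight_nonneg (v : List α) : 0 ≤ weight a r m v := by
  rw [weight]
  split_ifs
  · exact Finset.prod_nonneg fun i _ => by split_ifs <;> positivity
  · exact le_rfl

theorem IsSystem.word_ne_nil (h : IsSystem a r m p) (i) : Sum.elim r a i ≠ [] := by
  rcases i with i | j
  · intro hi
    have h1 := h.length_eq i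
    have h2 := h.two_le
    simp only [Sum.elim_inl] at hi
    rw [hi, List.length_nil] at h1
    omega
  · exact h.ne_nil j

theorem IsSystem.word_length_le (h : IsSystem a r m p) (i) : (Sum.elim r a i).length ≤ p := by
  rcases i with i | j
  · exact (h.length_eq i).le
  · exact h.length_le j

theorem IsSystem.avoids_all (h : IsSystem a r m p) {X : List α} (hX : Avoids a X)
    (hlen : X.length < p) : Avoids (Sum.elim r a) X := by
  rintro (i | j) hi
  · have h1 := hi.length_le
    rw [Sum.elim_inl, h.length_eq i] at h1
    omega
  · exact hX j hi

theorem IsSystem.avoids_word_tail (h : IsSystem a r m p) (i) :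
    Avoids a (Sum.elim r a i).tail := by
  intro j hj
  have h1 : Sum.elim r a (Sum.inr j) <:+: Sum.elim r a i := hj.trans (List.tail_suffix _).isInfix
  have h2 := h.reduced _ _ h1
  have h3 := hj.length_le
  rw [← h2, List.length_tail] at h3
  simp only [Sum.elim_inr] at h3
  have := List.length_pos_iff.2 (h.ne_nil j)
  omega

theorem IsSystem.avoids_repeated (h : IsSystem a r m p) (i : Fin ℓ) : Avoids a (r i) :=
  fun j hj => Sum.inr_ne_inl (h.reduced (Sum.inr j) (Sum.inl i) hj)

theorem IsSystem.weight_repeated (h : IsSystem a r m p) (i : Fin ℓ) :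
    weight a r m (r i) = m i := by
  rw [weight, if_pos (h.avoids_repeated i), Finset.prod_eq_single i]
  · simp
  · intro j _ hj
    refine if_neg fun heq => hj ?_
    have : Sum.elim r a (Sum.inl j) <:+: Sum.elim r a (Sum.inl i) := by
      simp only [Sum.elim_inl, heq]
      exact List.infix_rfl
    exact Sum.inl_injective (h.reduced _ _ this)
  · simp

variable [DecidableEq α]

/-- The potential with coefficients `D(z) c` with respect to all the given words. -/
noncomputable def pot (a : Fin s → List α) (r : Fin ℓ → List α) (m : Fin ℓ → ℕ) (z κ : ℝ)
    (c : Fin ℓ ⊕ Fin s → ℝ) (X : List α) : ℝ :=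
  potential (Sum.elim r a) (coef m z c) κ z X

/-- The linear system `Q(z) c = κ 1`, in terms of the values of the potential. -/
def IsSolution (a : Fin s → List α) (r : Fin ℓ → List α) (m : Fin ℓ → ℕ) (p : ℕ) (z κ : ℝ)
    (c : Fin ℓ ⊕ Fin s → ℝ) : Prop :=
  (∀ j, pot a r m z κ c (a j) = 0) ∧ ∀ i, pot a r m z κ c (r i) = -(z ^ p * c (Sum.inl i))

theorem pot_neg (X : List α) : pot a r m z (-κ) (-c) X = -pot a r m z κ c X := by
  rw [pot, coef_neg, potential_neg, pot]

theorem IsSolution.neg (h : IsSolution a r m p z κ c) : IsSolution a r m p z (-κ) (-c) := by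
  refine ⟨fun j => ?_, fun i => ?_⟩
  · rw [pot_neg, h.1, neg_zero]
  · rw [pot_neg, h.2, Pi.neg_apply, mul_neg]

/-- By `potential_word`, φ(r) = φ(r̃) - (1 - 1/m) z^p c, and z^p c = -φ(r) for a solution, so φ(r)/m
= φ(r̃). This is where the factor 1 - 1/m comes from. -/
theorem IsSystem.pot_repeated (h : IsSystem a r m p) (hs : IsSolution a r m p z κ c)
    (i : Fin ℓ) : pot a r m z κ c (r i) = m i * pot a r m z κ c (r i).tail := by
  have h1 := potential_word h.reduced (coef m z c) κ z (h.word_ne_nil (Sum.inl i))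
  have h2 := hs.2 i
  simp only [Sum.elim_inl] at h1
  change pot a r m z κ c (r i) = pot a r m z κ c (r i).tail - _ at h1
  have hm : (m i : ℝ) ≠ 0 := by
    have := h.mult i
    positivity
  have h3 : coef m z c (Sum.inl i) * z ^ ((r i).length - 1) =
      (1 - 1 / (m i : ℝ)) * (z ^ p * c (Sum.inl i)) := by
    obtain ⟨n, rfl⟩ : ∃ n, p = n + 1 := ⟨p - 1, by have := h.two_le; omega⟩
    rw [h.length_eq i, coef, Sum.elim_inl, Nat.add_sub_cancel, pow_succ]
    ring
  rw [h3, ← neg_eq_iff_eq_neg.2 h2] at h1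
  field_simp at h1
  linarith

/-- A word that ends in a forbidden word has zero potential. -/
theorem IsSystem.pot_eq_zero (h : IsSystem a r m p) (hs : IsSolution a r m p z κ c) {X : List α}
    {y : α} (hX : Avoids a X) (hlen : X.length < p) (hXy : ¬ Avoids a (X ++ [y])) :
    pot a r m z κ c (X ++ [y]) = 0 := by
  simp only [Avoids, not_forall, not_not] at hXy
  obtain ⟨j, hj⟩ := hXy
  rcases List.infix_concat_iff.1 hj with hj | hj
  · obtain ⟨b, hb⟩ := hj
    rw [← hb, pot]
    change potential _ _ _ _ (b ++ Sum.elim r a (Sum.inr j)) = 0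
    rw [potential_append_word h.reduced]
    · exact hs.1 j
    · change Avoids _ (b ++ a j).dropLast
      rw [hb, List.dropLast_concat]
      exact h.avoids_all hX hlen
  · exact absurd hj (hX j)

/-- Three cases: the word ends in a forbidden word and both sides vanish; it is some `r i`; or it
agrees with no given word, all of which have length at most `p`, and dropping its first symbol
leaves the potential unchanged. -/
theorem IsSystem.weight_mul_pot_tail (h : IsSystem a r m p) (hs : IsSolution a r m p z κ c)
    {X : List α} (y : α) (hX : Avoids a X) (hlen : X.length + 1 = p) :
    weight a r m (X ++ [y]) * pot a r m z κ c (X ++ [y]).tail = pot a r m z κ c (X ++ [y]) := by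
  by_cases hav : Avoids a (X ++ [y])
  · by_cases hr : ∃ i, X ++ [y] = r i
    · obtain ⟨i, hi⟩ := hr
      rw [hi, h.weight_repeated, h.pot_repeated hs]
    · have hw : weight a r m (X ++ [y]) = 1 := by
        rw [weight, if_pos hav]
        exact Finset.prod_eq_one fun i _ => if_neg fun hi => hr ⟨i, hi⟩
      rw [hw, one_mul]
      obtain ⟨x, Y, hY⟩ := List.exists_cons_of_ne_nil (show X ++ [y] ≠ [] by simp)
      have hall : Avoids (Sum.elim r a) (x :: Y) := by
        rw [← hY]
        rintro (i | j) hi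
        · refine hr ⟨i, (hi.eq_of_length ?_).symm⟩
          simp [h.length_eq, hlen]
        · exact hav j hi
      have hl : (x :: Y).length = p := by simp [← hY, hlen]
      rw [hY, List.tail_cons, pot, pot, potential_cons_of_not_agree]
      rintro j (h1 | h1)
      · have := h1.eq_of_length_le (by rw [hl]; exact h.word_length_le j)
        exact hall j (this ▸ List.infix_rfl)
      · exact hall j h1.isInfix
  · rw [weight, if_neg hav, zero_mul, h.pot_eq_zero hs hX (by omega) hav]

/-- The potential is a right eigenvector, up to the defect. -/
theorem IsSystem.sum_weight_mul_pot [Fintype α] (h : IsSystem a r m p)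
    (hs : IsSolution a r m p z κ c) {X : List α} (hX : Avoids a X) (hlen : X.length + 1 = p) :
    ∑ y, weight a r m (X ++ [y]) * pot a r m z κ c (X ++ [y]).tail =
      z * pot a r m z κ c X + defect (α := α) m z κ c := by
  simp only [h.weight_mul_pot_tail hs _ hX hlen, defect]
  exact sum_potential_concat _ _ _ (h.avoids_all hX (by omega))

theorem IsSystem.mul_pot_eq [Fintype α] (h : IsSystem a r m p)
    (hd : defect (α := α) m z κ c = 0) {X : List α} (hX : Avoids a X) (hlen : X.length < p) :
    z * pot a r m z κ c X = ∑ y, pot a r m z κ c (X ++ [y]) := by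
  have h1 := sum_potential_concat (coef m z c) κ z (h.avoids_all hX hlen)
  change _ = _ + defect (α := α) m z κ c at h1
  rw [hd, add_zero] at h1
  exact h1.symm

/-- Nonnegativity passes from words of length `p - 1` to shorter ones. -/
theorem IsSystem.pot_nonneg [Fintype α] (h : IsSystem a r m p) (hs : IsSolution a r m p z κ c)
    (hz : 0 < z) (hd : defect (α := α) m z κ c = 0)
    (hnn : ∀ X : List α, Avoids a X → X.length + 1 = p → 0 ≤ pot a r m z κ c X)
    (n : ℕ) : ∀ X : List α, Avoids a X → X.length + 1 + n = p → 0 ≤ pot a r m z κ c X := by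
  induction n with
  | zero => exact hnn
  | succ n ih =>
    intro X hX hlen
    have h1 := h.mul_pot_eq hd hX (by omega)
    have h2 : 0 ≤ ∑ y, pot a r m z κ c (X ++ [y]) := by
      refine Finset.sum_nonneg fun y _ => ?_
      by_cases hav : Avoids a (X ++ [y])
      · exact ih _ hav (by simp; omega)
      · rw [h.pot_eq_zero hs hX (by omega) hav]
    rw [← h1] at h2
    exact nonneg_of_mul_nonneg_right h2 hz

/-- Positivity descends through the prefixes of `X`: one positive extension among nonnegative ones
makes the average positive. The empty word has potential `κ`. -/
theorem IsSystem.const_pos [Fintype α] (h : IsSystem a r m p) (hs : IsSolution a r m p z κ c)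
    (hz : 0 < z) (hd : defect (α := α) m z κ c = 0)
    (hnn : ∀ X : List α, Avoids a X → X.length + 1 = p → 0 ≤ pot a r m z κ c X)
    (X : List α) (hX : Avoids a X) (hlen : X.length < p) (hpos : 0 < pot a r m z κ c X) :
    0 < κ := by
  induction X using List.reverseRecOn with
  | nil => rwa [pot, potential_nil] at hpos
  | append_singleton X y ih =>
    rw [List.length_append, List.length_singleton] at hlen
    have hX' : Avoids a X := hX.of_infix (List.prefix_append _ _).isInfix
    refine ih hX' (by omega) ?_
    have h1 := h.mul_pot_eq hd hX' (by omega)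
    refine (mul_pos_iff_of_pos_left hz).1 ?_
    rw [h1]
    refine Finset.sum_pos' (fun y _ => ?_) ⟨y, Finset.mem_univ y, hpos⟩
    by_cases hav : Avoids a (X ++ [y])
    · exact h.pot_nonneg hs hz hd hnn (p - (X.length + 2)) _ hav (by simp; omega)
    · rw [h.pot_eq_zero hs hX' (by omega) hav]

theorem IsSystem.pot_eq_zero_of_short [Fintype α] (h : IsSystem a r m p)
    (hs : IsSolution a r m p z κ c) (hz : 0 < z) (hd : defect (α := α) m z κ c = 0)
    (h0 : ∀ X : List α, Avoids a X → X.length + 1 = p → pot a r m z κ c X = 0)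
    {X : List α} (hX : Avoids a X) (hlen : X.length < p) : pot a r m z κ c X = 0 := by
  apply le_antisymm
  · have := h.pot_nonneg hs.neg hz (by rw [defect_neg, hd, neg_zero])
      (fun X hX hl => by rw [pot_neg, h0 X hX hl, neg_zero]) (p - (X.length + 1)) X hX (by omega)
    rw [pot_neg] at this
    linarith
  · exact h.pot_nonneg hs hz hd (fun X hX hl => (h0 X hX hl).ge) (p - (X.length + 1)) X hX
      (by omega)

/-- If the potential vanishes on words of length `p - 1`, then the solution is trivial. -/
theorem IsSystem.solution_eq_zero [Fintype α] (h : IsSystem a r m p)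
    (hs : IsSolution a r m p z κ c) (hz : 0 < z) (hd : defect (α := α) m z κ c = 0)
    (h0 : ∀ X : List α, Avoids a X → X.length + 1 = p → pot a r m z κ c X = 0) :
    κ = 0 ∧ c = 0 := by
  have hp := h.two_le
  have hshort : ∀ X : List α, Avoids a X → X.length < p → pot a r m z κ c X = 0 :=
    fun X => h.pot_eq_zero_of_short hs hz hd h0
  have htail : ∀ i, pot a r m z κ c (Sum.elim r a i).tail = 0 := fun i => by
    refine hshort _ (h.avoids_word_tail i) ?_
    have := h.word_length_le i
    rw [List.length_tail]
    omega
  refine ⟨?_, ?_⟩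
  · have := hshort [] (fun j hj => h.ne_nil j (List.infix_nil.1 hj)) (by simp; omega)
    rwa [pot, potential_nil] at this
  -- With vanishing potential on all tails, each coefficient is read off from the value at its own
  -- word.
  · ext (i | j)
    · have h1 := h.pot_repeated hs i
      have h2 := htail (Sum.inl i)
      rw [Sum.elim_inl] at h2
      rw [h2, mul_zero, hs.2 i, neg_eq_zero] at h1
      exact (mul_eq_zero.1 h1).resolve_left (pow_pos hz p).ne'
    · have h1 := potential_word h.reduced (coef m z c) κ z (h.word_ne_nil (Sum.inr j))
      have h2 := htail (Sum.inr j)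
      have h3 := hs.1 j
      simp only [pot, Sum.elim_inr] at h1 h2 h3
      rw [h2, h3, zero_sub, coef, Sum.elim_inr, eq_comm, neg_eq_zero] at h1
      have h4 := (mul_eq_zero.1 h1).resolve_right (pow_pos hz _).ne'
      exact (mul_eq_zero.1 h4).resolve_left (neg_ne_zero.2 hz.ne')

/-- If the potential has a constant strict sign on a nonempty part of the words of length `p - 1`,
and this weak sign on all of them, then the solution is nontrivial, and the constant has
this sign. -/
theorem IsSystem.pot_sign [Fintype α] (h : IsSystem a r m p) (hs : IsSolution a r m p z κ c)
    (hz : 0 < z) (hd : defect (α := α) m z κ c = 0) {S : Set (List α)} (hS : S.Nonempty)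
    (hSa : ∀ X ∈ S, Avoids a X ∧ X.length + 1 = p)
    (htri : (∀ X ∈ S, pot a r m z κ c X = 0) ∨ (∀ X ∈ S, 0 < pot a r m z κ c X) ∨
      ∀ X ∈ S, pot a r m z κ c X < 0)
    (hpos : (∀ X ∈ S, 0 ≤ pot a r m z κ c X) →
      ∀ X : List α, Avoids a X → X.length + 1 = p → 0 ≤ pot a r m z κ c X)
    (hneg : (∀ X ∈ S, pot a r m z κ c X ≤ 0) →
      ∀ X : List α, Avoids a X → X.length + 1 = p → pot a r m z κ c X ≤ 0) :
    (κ = 0 → c = 0) ∧ (0 < κ → ∀ X ∈ S, 0 < pot a r m z κ c X) := by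
  obtain ⟨X₀, hX₀⟩ := hS
  obtain ⟨hav, hlen⟩ := hSa X₀ hX₀
  rcases htri with h0 | h0 | h0
  · obtain ⟨h1, h2⟩ := h.solution_eq_zero hs hz hd fun X hX hl =>
      le_antisymm (hneg (fun X hX => (h0 X hX).le) X hX hl)
        (hpos (fun X hX => (h0 X hX).ge) X hX hl)
    exact ⟨fun _ => h2, fun hκ => absurd h1 hκ.ne'⟩
  · have h1 := h.const_pos hs hz hd (hpos fun X hX => (h0 X hX).le) X₀ hav (by omega) (h0 X₀ hX₀)
    exact ⟨fun hκ => absurd hκ h1.ne', fun _ => h0⟩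
  · have h1 := h.const_pos hs.neg hz (by rw [defect_neg, hd, neg_zero])
      (fun X hX hl => by
        rw [pot_neg]
        exact neg_nonneg.2 (hneg (fun X hX => (h0 X hX).le) X hX hl)) X₀ hav (by omega)
      (by rw [pot_neg]; exact neg_pos.2 (h0 X₀ hX₀))
    exact ⟨fun hκ => by rw [hκ, neg_zero] at h1; exact absurd h1 (lt_irrefl _),
      fun hκ => by linarith⟩

end Engine

/-! ### Allowed words versus words that merely avoid the forbidden ones. -/

section Language

variable {α ι : Type*} {a : ι → List α}

theorem length_block (x : ℕ → α) (k n : ℕ) : (block x k n).length = n :=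
  List.length_ofFn

theorem block_succ (x : ℕ → α) (k n : ℕ) : block x k (n + 1) = x k :: block x (k + 1) n := by
  simp only [block, List.ofFn_succ, Fin.val_zero, add_zero, Fin.val_succ]
  congr 2
  ext i
  rw [add_assoc, add_comm 1]

theorem block_add (x : ℕ → α) (k n l : ℕ) :
    block x k (n + l) = block x k n ++ block x (k + n) l := by
  induction n generalizing k with
  | zero => simp [block]
  | succ n ih =>
    rw [add_right_comm, block_succ, ih, block_succ, List.cons_append, add_assoc k, add_comm 1 n]

theorem block_of_infix {x : ℕ → α} {k n : ℕ} {u : List α} (h : u <:+: block x k n) :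
    ∃ k', block x k' u.length = u := by
  obtain ⟨b, t, h⟩ := h
  have hn : n = b.length + u.length + t.length := by
    rw [← length_block x k n, ← h, List.length_append, List.length_append]
  rw [hn, block_add, block_add] at h
  have h1 := (List.append_inj' h (by rw [length_block])).1
  exact ⟨k + b.length, (List.append_inj' h1 (by rw [length_block])).2.symm⟩

theorem mem_language_of_infix {n : ℕ} {u w : List α} (hw : w ∈ language a n) (h : u <:+: w) :
    u ∈ language a u.length := by
  obtain ⟨-, x, hx, k, rfl⟩ := hw
  exact ⟨rfl, x, hx, block_of_infix h⟩

theorem avoids_of_mem_language {n : ℕ} {w : List α} (hw : w ∈ language a n) : Avoids a w := by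
  obtain ⟨-, x, hx, k, rfl⟩ := hw
  intro j hj
  obtain ⟨k', hk'⟩ := block_of_infix hj
  exact hx j k' hk'

/-- In a one-sided shift a symbol can be put in front of a point: a new forbidden occurrence would
start at `x` and fit inside `x :: Y`. -/
theorem cons_mem_language {n : ℕ} {x : α} {Y : List α} (ha : ∀ j, (a j).length ≤ n + 1)
    (hY : Y ∈ language a n) (h : Avoids a (x :: Y)) : x :: Y ∈ language a (n + 1) := by
  obtain ⟨hlen, ξ, hξ, k, rfl⟩ := hY
  set ζ : ℕ → α := fun i => Nat.casesOn i x fun i => ξ (k + i) with hζ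
  have hblock : ∀ i l, block ζ (i + 1) l = block ξ (k + i) l := fun i l => by
    simp only [block, hζ]
    congr 1
    ext t
    rw [show i + 1 + (t : ℕ) = (i + t) + 1 by omega]
    simp only [add_assoc]
  have h0 : block ζ 0 (n + 1) = x :: block ξ k n := by
    rw [block_succ, hblock 0, add_zero]
    rfl
  refine ⟨by rw [List.length_cons, hlen], ζ, fun j i => ?_, 0, h0⟩
  cases i with
  | zero =>
    intro hj
    refine h j ?_
    rw [← h0, ← hj]
    obtain ⟨l, hl⟩ := Nat.exists_eq_add_of_le (ha j)
    rw [hl, block_add]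
    exact (List.prefix_append _ _).isInfix
  | succ i =>
    rw [hblock]
    exact hξ j _

/-- A sequence of words of length `n`, in which each is obtained from the preceding one by
dropping the first symbol and appending a new one, consists of the blocks of a point. -/
theorem exists_blocks {n : ℕ} {f : ℕ → List α} (hn : 0 < n) (hlen : ∀ k, (f k).length = n)
    (hf : ∀ k, ∃ y, f (k + 1) = (f k ++ [y]).tail) : ∃ x : ℕ → α, ∀ k, block x k n = f k := by
  have hne : ∀ k, f k ≠ [] := fun k => List.length_pos_iff.1 (by rw [hlen]; exact hn)
  refine ⟨fun k => (f k).head (hne k), ?_⟩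
  have key : ∀ j ≤ n, ∀ k, block (fun k => (f k).head (hne k)) k j <+: f k := by
    intro j
    induction j with
    | zero => simp [block]
    | succ j ih =>
      intro hj k
      rw [block_succ]
      obtain ⟨y, hy⟩ := hf k
      have h1 := ih (by omega) (k + 1)
      rw [hy, List.tail_append_of_ne_nil (hne k)] at h1
      have h2 := List.prefix_of_prefix_length_le h1 (List.prefix_append _ _)
        (by rw [length_block, List.length_tail, hlen]; omega)
      conv_rhs => rw [← List.cons_head_tail (hne k)]
      exact (List.prefix_cons_inj _).2 h2
  exact fun k => (key n le_rfl k).eq_of_length (by rw [length_block, hlen])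

/-- Words avoiding `a` that are not allowed cannot be continued to the right forever. -/
theorem wellFounded_step {n : ℕ} (hn : 0 < n) (ha : ∀ j, (a j).length ≤ n + 1) :
    WellFounded fun Y X : {X : List α // X.length = n ∧ X ∉ language a n} =>
      ∃ y, Avoids a ((X : List α) ++ [y]) ∧ (Y : List α) = ((X : List α) ++ [y]).tail := by
  rw [wellFounded_iff_isEmpty_descending_chain]
  refine ⟨fun ⟨f, hf⟩ => ?_⟩
  obtain ⟨x, hx⟩ := exists_blocks (f := fun k => (f k : List α)) hn (fun k => (f k).2.1)
    fun k => (hf k).imp fun y hy => hy.2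
  refine (f 0).2.2 ⟨(f 0).2.1, x, fun j k hj => ?_, 0, hx 0⟩
  obtain ⟨y, hav, hy⟩ := hf k
  have hne : (f k : List α) ≠ [] := List.length_pos_iff.1 (by rw [(f k).2.1]; exact hn)
  have h1 : block x k (n + 1) = (f k : List α) ++ [y] := by
    have hk := hx k
    obtain ⟨l, rfl⟩ : ∃ l, n = l + 1 := ⟨n - 1, by omega⟩
    rw [block_succ, hx (k + 1), hy, ← hk, block_succ]
    simp
  refine hav j ?_
  rw [← h1, ← hj]
  obtain ⟨l, hl⟩ := Nat.exists_eq_add_of_le (ha j)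
  rw [hl, block_add]
  exact (List.prefix_append _ _).isInfix

/-- Otherwise `cons_mem_language` would make `X ++ [y]`, and with it `X`, allowed. -/
theorem tail_not_mem_language {n : ℕ} (hn : 0 < n) (ha : ∀ j, (a j).length ≤ n + 1) {X : List α}
    (hlen : X.length = n) (hX : X ∉ language a n) {y : α} (hav : Avoids a (X ++ [y])) :
    (X ++ [y]).tail ∉ language a n := by
  intro h
  obtain ⟨x, X, rfl⟩ := List.exists_cons_of_length_pos (hlen.symm ▸ hn)
  rw [List.cons_append, List.tail_cons] at h
  have h1 := mem_language_of_infix (cons_mem_language ha h hav)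
    (List.prefix_append (x :: X) [y]).isInfix
  rw [hlen] at h1
  exact hX h1

/-- Induction along the successors of a word that is not allowed. -/
theorem forward_induction {n : ℕ} (hn : 0 < n) (ha : ∀ j, (a j).length ≤ n + 1)
    {P : List α → Prop}
    (hP : ∀ X : List α, X.length = n → Avoids a X → X ∉ language a n →
      (∀ y, Avoids a (X ++ [y]) → P (X ++ [y]).tail) → P X)
    (X : List α) (hlen : X.length = n) (hX : Avoids a X) (hX' : X ∉ language a n) : P X := by
  suffices h : ∀ X : {X : List α // X.length = n ∧ X ∉ language a n},
      Avoids a (X : List α) → P X from h ⟨X, hlen, hX'⟩ hX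
  intro X
  induction X using (wellFounded_step hn ha).induction with
  | _ X ih =>
    intro hX
    refine hP X X.2.1 hX X.2.2 fun y hy => ?_
    exact ih ⟨((X : List α) ++ [y]).tail, by simp [X.2.1],
      tail_not_mem_language hn ha X.2.1 X.2.2 hy⟩ ⟨y, hy, rfl⟩
      (hy.of_infix (List.tail_suffix _).isInfix)

/-- Induction along the predecessors of a word that is not allowed. -/
theorem backward_induction [Finite α] {n : ℕ} (hn : 0 < n) (ha : ∀ j, (a j).length ≤ n + 1)
    {P : List α → Prop}
    (hP : ∀ X : List α, X.length = n → Avoids a X → X ∉ language a n →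
      (∀ x, Avoids a (x :: X) → (x :: X).dropLast ∉ language a n → P (x :: X).dropLast) → P X)
    (X : List α) (hlen : X.length = n) (hX : Avoids a X) (hX' : X ∉ language a n) : P X := by
  suffices h : ∀ X : {X : List α // X.length = n ∧ X ∉ language a n},
      Avoids a (X : List α) → P X from h ⟨X, hlen, hX'⟩ hX
  have hfin : Finite {X : List α // X.length = n ∧ X ∉ language a n} :=
    ((List.finite_length_eq α n).subset fun X hX => hX.1).to_subtype
  -- The transitive closure of a well-founded relation is irreflexive, so on a finite set its
  -- converse is well-founded too.
  have hwf := (wellFounded_step hn ha).transGen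
  have := hwf.irrefl
  have hwf' := Finite.wellFounded_of_trans_of_irrefl (Function.swap (Relation.TransGen
    fun Y X : {X : List α // X.length = n ∧ X ∉ language a n} =>
      ∃ y, Avoids a ((X : List α) ++ [y]) ∧ (Y : List α) = ((X : List α) ++ [y]).tail))
  intro X
  induction X using hwf'.induction with
  | _ X ih =>
    intro hX
    refine hP X X.2.1 hX X.2.2 fun x hx hx' => ?_
    have hne : (X : List α) ≠ [] := List.length_pos_iff.1 (by rw [X.2.1]; exact hn)
    have hconcat : (x :: (X : List α)).dropLast ++ [(X : List α).getLast hne] = x :: X := by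
      rw [List.dropLast_cons_of_ne_nil hne, List.cons_append, List.dropLast_append_getLast]
    refine ih ⟨(x :: (X : List α)).dropLast, by simp [X.2.1], hx'⟩ (Relation.TransGen.single
      ⟨(X : List α).getLast hne, ?_, ?_⟩) (hx.of_infix (List.dropLast_prefix _).isInfix)
    · rw [hconcat]
      exact hx
    · rw [hconcat]
      rfl

end Language

/-! ### The adjacency matrix as a weighted sum over one-symbol extensions. -/

section Adjacency

theorem star_concat {α : Type*} (X Y : List α) (y : α) : star X (Y ++ [y]) = X ++ [y] := by
  simp [star]

variable {α : Type*} [DecidableEq α] {s ℓ : ℕ} {a : Fin s → List α} {r : Fin ℓ → List α}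
  {m : Fin ℓ → ℕ} {p : ℕ}

theorem occurrences_of_length_eq {v w : List α} (hw : w ≠ []) (h : v.length = w.length) :
    occurrences v w = if v = w then 1 else 0 := by
  have hv : 0 < v.length := h ▸ List.length_pos_iff.2 hw
  have key : ∀ i, w <+: v.drop i ↔ i = 0 ∧ v = w := by
    intro i
    constructor
    · intro hi
      have h1 := hi.length_le
      rw [List.length_drop] at h1
      obtain rfl : i = 0 := by omega
      exact ⟨rfl, (hi.eq_of_length (by simp [h])).symm⟩
    · rintro ⟨rfl, rfl⟩
      exact List.prefix_rfl
  rw [occurrences]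
  simp only [key]
  split_ifs with hvw
  · rw [Finset.card_eq_one]
    refine ⟨0, ?_⟩
    ext i
    simp only [Finset.mem_filter, Finset.mem_range, Finset.mem_singleton]
    exact ⟨fun hi => hi.2.1, fun hi => ⟨hi ▸ hv, hi, hvw⟩⟩
  · rw [Finset.card_eq_zero, Finset.filter_eq_empty_iff]
    exact fun i _ hi => hvw hi.2

theorem occurrences_of_length_lt {v w : List α} (h : v.length < w.length) :
    occurrences v w = 0 := by
  rw [occurrences, Finset.card_eq_zero, Finset.filter_eq_empty_iff]
  intro i _ hi
  have := hi.length_le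
  rw [List.length_drop] at this
  omega

/-- The tail of `v` is too short to contain a repeated word, so the denominator is 1. -/
theorem IsSystem.relMultiplicity_eq (h : IsSystem a r m p) {v : List α}
    (hv : v ∈ language a p) : (relMultiplicity a r m v : ℝ) = weight a r m v := by
  have hlen := hv.1
  have hp := h.two_le
  have hall : IsAllowed a v := by
    rw [IsAllowed, hlen]
    exact hv
  have hall' : IsAllowed a v.tail := mem_language_of_infix hv (List.tail_suffix _).isInfix
  have htail : multiplicity a r m v.tail = 1 := by
    rw [multiplicity, if_pos hall']
    refine Finset.prod_eq_one fun i _ => ?_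
    rw [occurrences_of_length_lt, pow_zero]
    rw [h.length_eq, List.length_tail]
    omega
  rw [relMultiplicity, htail, Nat.div_one, multiplicity, if_pos hall, weight,
    if_pos (avoids_of_mem_language hv), Nat.cast_prod]
  refine Finset.prod_congr rfl fun i _ => ?_
  have hr : r i ≠ [] := h.word_ne_nil (Sum.inl i)
  rw [occurrences_of_length_eq hr (by rw [h.length_eq, hlen])]
  split_ifs <;> simp

variable [Fintype α]

open Classical in
theorem IsSystem.sum_adjacency_mul (h : IsSystem a r m p) (f : List α → ℝ)
    (X : language a (p - 1)) :
    ∑ Y : language a (p - 1), adjacency a r m p X Y * f Y =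
      ∑ y, if (X : List α) ++ [y] ∈ language a p then
        weight a r m ((X : List α) ++ [y]) * f ((X : List α) ++ [y]).tail else 0 := by
  have hp := h.two_le
  have hX : (X : List α) ≠ [] := List.length_pos_iff.1 (by rw [X.2.1]; omega)
  have h1 : ∀ Y : language a (p - 1), adjacency a r m p X Y * f Y =
      ∑ y, if (Y : List α) = ((X : List α) ++ [y]).tail ∧ (X : List α) ++ [y] ∈ language a p then
        weight a r m ((X : List α) ++ [y]) * f ((X : List α) ++ [y]).tail else 0 := by
    intro Y
    obtain ⟨y₀, hy₀⟩ : ∃ y₀, (Y : List α) = (Y : List α).dropLast ++ [y₀] :=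
      ⟨_, (List.dropLast_append_getLast (List.length_pos_iff.1 (by rw [Y.2.1]; omega))).symm⟩
    set Y' := (Y : List α).dropLast with hY'
    rw [Finset.sum_eq_single y₀]
    · rw [adjacency, Matrix.of_apply, ← hY', hy₀, star_concat, List.tail_append_of_ne_nil hX,
        if_congr (and_congr_left' (List.append_left_inj _)) rfl rfl]
      by_cases hc : (X : List α).tail = Y' ∧ (X : List α) ++ [y₀] ∈ language a p
      · rw [if_pos hc, if_pos ⟨hc.1.symm, hc.2⟩, h.relMultiplicity_eq hc.2, hc.1]
      · rw [if_neg hc, if_neg fun hc' => hc ⟨hc'.1.symm, hc'.2⟩, zero_mul]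
    · intro y _ hy
      refine if_neg fun hc => hy ?_
      rw [hy₀, List.tail_append_of_ne_nil hX] at hc
      have := (List.append_inj' hc.1 rfl).2
      simpa using this.symm
    · simp
  simp only [h1]
  rw [Finset.sum_comm]
  refine Finset.sum_congr rfl fun y _ => ?_
  split_ifs with hy
  · have hmem : ((X : List α) ++ [y]).tail ∈ language a (p - 1) := by
      have := mem_language_of_infix hy (List.tail_suffix _).isInfix
      rwa [List.length_tail, hy.1] at this
    rw [Finset.sum_eq_single ⟨_, hmem⟩]
    · simp [hy]
    · intro Y _ hne
      exact if_neg fun hc => hne (Subtype.ext hc.1)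
    · simp
  · exact Finset.sum_eq_zero fun Y _ => if_neg fun hc => hy hc.2

open Classical in
theorem IsSystem.sum_mul_adjacency (h : IsSystem a r m p) (f : List α → ℝ)
    (Y : language a (p - 1)) :
    ∑ X : language a (p - 1), f X * adjacency a r m p X Y =
      ∑ x, if x :: (Y : List α) ∈ language a p then
        weight a r m (x :: Y) * f (x :: (Y : List α)).dropLast else 0 := by
  have hp := h.two_le
  have hY : (Y : List α) ≠ [] := List.length_pos_iff.1 (by rw [Y.2.1]; omega)
  have h1 : ∀ X : language a (p - 1), f X * adjacency a r m p X Y =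
      ∑ x, if (X : List α) = (x :: (Y : List α)).dropLast ∧ x :: (Y : List α) ∈ language a p then
        weight a r m (x :: Y) * f (x :: (Y : List α)).dropLast else 0 := by
    intro X
    obtain ⟨x₀, X', hX⟩ := List.exists_cons_of_length_pos
      (show 0 < (X : List α).length by rw [X.2.1]; omega)
    have hstar : ∀ x, star (x :: (Y : List α).dropLast) (Y : List α) = x :: Y := fun x => by
      conv_lhs => rw [← List.dropLast_append_getLast hY]
      rw [star_concat, List.dropLast_concat, List.cons_append, List.dropLast_append_getLast]
    rw [Finset.sum_eq_single x₀]
    · rw [adjacency, Matrix.of_apply, hX, List.tail_cons, List.dropLast_cons_of_ne_nil hY,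
        if_congr (and_congr_left' (List.cons_inj_right _)) rfl rfl]
      by_cases hc : X' = (Y : List α).dropLast
      · rw [hc, hstar]
        by_cases hm : x₀ :: (Y : List α) ∈ language a p
        · rw [if_pos ⟨rfl, hm⟩, if_pos ⟨rfl, hm⟩, h.relMultiplicity_eq hm, mul_comm]
        · rw [if_neg fun hc => hm hc.2, if_neg fun hc => hm hc.2, mul_zero]
      · rw [if_neg fun h => hc h.1, if_neg fun h => hc h.1, mul_zero]
    · intro x _ hx
      refine if_neg fun hc => hx ?_
      rw [hX, List.dropLast_cons_of_ne_nil hY] at hc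
      exact (List.cons.inj hc.1).1.symm
    · simp
  simp only [h1]
  rw [Finset.sum_comm]
  refine Finset.sum_congr rfl fun x _ => ?_
  split_ifs with hx
  · have hmem : (x :: (Y : List α)).dropLast ∈ language a (p - 1) := by
      have := mem_language_of_infix hx (List.dropLast_prefix _).isInfix
      rwa [List.length_dropLast, hx.1] at this
    rw [Finset.sum_eq_single ⟨_, hmem⟩]
    · simp [hx]
    · intro X _ hne
      exact if_neg fun hc => hne (Subtype.ext hc.1)
    · simp
  · exact Finset.sum_eq_zero fun X _ => if_neg fun hc => hx hc.2

end Adjacency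

/-! ### Left and right eigenvectors from potentials. -/

section Eigenvectors

theorem IsSystem.length_le_pred_add_one {α : Type*} {s ℓ : ℕ} {a : Fin s → List α}
    {r : Fin ℓ → List α} {m : Fin ℓ → ℕ} {p : ℕ} (h : IsSystem a r m p) (j : Fin s) :
    (a j).length ≤ p - 1 + 1 := by
  have h1 := h.two_le
  have h2 := h.length_le j
  omega

theorem IsSystem.cons_mem_language {α : Type*} {s ℓ : ℕ} {a : Fin s → List α}
    {r : Fin ℓ → List α} {m : Fin ℓ → ℕ} {p : ℕ} (h : IsSystem a r m p) {x : α} {Y : List α}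
    (hY : Y ∈ language a (p - 1)) (hav : Avoids a (x :: Y)) : x :: Y ∈ language a p := by
  have h1 := RepeatedShift.cons_mem_language h.length_le_pred_add_one hY hav
  rwa [Nat.sub_add_cancel (by have := h.two_le; omega)] at h1

variable {α : Type*} [DecidableEq α] [Fintype α] {s ℓ : ℕ} {a : Fin s → List α}
  {r : Fin ℓ → List α} {m : Fin ℓ → ℕ} {p : ℕ} {z κ : ℝ} {c : Fin ℓ ⊕ Fin s → ℝ}

/-- With zero defect, the potential vanishes on the words avoiding `a` that are not allowed. -/
theorem IsSystem.pot_eq_zero_of_not_mem (h : IsSystem a r m p) (hs : IsSolution a r m p z κ c)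
    (hz : 0 < z) (hd : defect (α := α) m z κ c = 0) {X : List α} (hX : Avoids a X)
    (hlen : X.length + 1 = p) (hX' : X ∉ language a (p - 1)) : pot a r m z κ c X = 0 := by
  have hp := h.two_le
  refine forward_induction (n := p - 1) (by omega) h.length_le_pred_add_one
    (P := fun X => pot a r m z κ c X = 0) ?_ X (by omega) hX hX'
  intro X hl hav _ ih
  have h1 := h.sum_weight_mul_pot hs hav (by omega)
  rw [hd, add_zero, Finset.sum_eq_zero] at h1
  · exact (mul_eq_zero.1 h1.symm).resolve_left hz.ne'
  · intro y _
    by_cases hy : Avoids a (X ++ [y])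
    · rw [ih y hy, mul_zero]
    · rw [weight, if_neg hy, zero_mul]

/-- With zero defect, the potential is a right eigenvector of the adjacency matrix. -/
theorem IsSystem.adjacency_mulVec_pot (h : IsSystem a r m p) (hs : IsSolution a r m p z κ c)
    (hz : 0 < z) (hd : defect (α := α) m z κ c = 0) :
    (adjacency a r m p).mulVec (fun Y => pot a r m z κ c Y) =
      z • fun Y : language a (p - 1) => pot a r m z κ c Y := by
  ext X
  have hp := h.two_le
  have hX := avoids_of_mem_language X.2
  have hlen := X.2.1
  have h1 := h.sum_weight_mul_pot hs hX (by omega)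
  rw [hd, add_zero] at h1
  rw [Pi.smul_apply, smul_eq_mul, ← h1]
  refine (h.sum_adjacency_mul (pot a r m z κ c) X).trans (Finset.sum_congr rfl fun y _ => ?_)
  by_cases hy : (X : List α) ++ [y] ∈ language a p
  · rw [if_pos hy]
  · rw [if_neg hy]
    -- An extension that avoids `a` without being allowed has a tail that is not allowed, where the
    -- potential vanishes.
    by_cases hav : Avoids a ((X : List α) ++ [y])
    · rw [h.pot_eq_zero_of_not_mem hs hz hd (hav.of_infix (List.tail_suffix _).isInfix), mul_zero]
      · simp only [List.length_tail, List.length_append, List.length_singleton]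
        omega
      · intro hmem
        obtain ⟨x, Y, hY⟩ := List.exists_cons_of_ne_nil (show (X : List α) ++ [y] ≠ [] by simp)
        rw [hY, List.tail_cons] at hmem
        rw [hY] at hav hy
        exact hy (h.cons_mem_language hmem hav)
    · rw [weight, if_neg hav, zero_mul]

/-- The potential for the reversed words, evaluated at the reversed word. -/
noncomputable def potRev (a : Fin s → List α) (r : Fin ℓ → List α) (m : Fin ℓ → ℕ) (z κ : ℝ)
    (c : Fin ℓ ⊕ Fin s → ℝ) (X : List α) : ℝ :=
  pot (fun j => (a j).reverse) (fun i => (r i).reverse) m z κ c X.reverse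

theorem IsSystem.sum_weight_mul_potRev (h : IsSystem a r m p)
    (hs : IsSolution (fun j => (a j).reverse) (fun i => (r i).reverse) m p z κ c)
    {Y : List α} (hY : Avoids a Y) (hlen : Y.length + 1 = p) :
    ∑ x, weight a r m (x :: Y) * potRev a r m z κ c (x :: Y).dropLast =
      z * potRev a r m z κ c Y + defect (α := α) m z κ c := by
  have h1 := h.reverse.sum_weight_mul_pot hs (avoids_reverse_iff.2 hY) (by simpa using hlen)
  rw [potRev, ← h1]
  refine Finset.sum_congr rfl fun x _ => ?_
  rw [← List.reverse_cons, weight_reverse, potRev, List.tail_reverse]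

/-- For the reversed words, the potential is a left eigenvector up to the defect. -/
theorem IsSystem.vecMul_potRev_adjacency (h : IsSystem a r m p)
    (hs : IsSolution (fun j => (a j).reverse) (fun i => (r i).reverse) m p z κ c)
    (Y : language a (p - 1)) :
    Matrix.vecMul (fun X : language a (p - 1) => potRev a r m z κ c X) (adjacency a r m p) Y =
      z * potRev a r m z κ c Y + defect (α := α) m z κ c := by
  have hp := h.two_le
  have hlen := Y.2.1
  rw [← h.sum_weight_mul_potRev hs (avoids_of_mem_language Y.2) (by omega)]
  refine (h.sum_mul_adjacency (potRev a r m z κ c) Y).trans (Finset.sum_congr rfl fun x _ => ?_)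
  by_cases hx : x :: (Y : List α) ∈ language a p
  · rw [if_pos hx]
  -- On the left no spurious terms arise: an extension of an allowed `Y` that avoids `a` is allowed.
  -- Hence zero defect is not needed here.
  · rw [if_neg hx, weight, if_neg fun hav => hx (h.cons_mem_language Y.2 hav), zero_mul]

/-- At a word that is not allowed, `z` times the value is a nonnegative combination of values at
predecessors, so the bound spreads by `backward_induction`. -/
theorem IsSystem.potRev_nonneg (h : IsSystem a r m p)
    (hs : IsSolution (fun j => (a j).reverse) (fun i => (r i).reverse) m p z κ c)
    (hz : 0 < z) (hd : defect (α := α) m z κ c = 0)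
    (hnn : ∀ X ∈ language a (p - 1), 0 ≤ potRev a r m z κ c X) {X : List α} (hX : Avoids a X)
    (hlen : X.length + 1 = p) : 0 ≤ potRev a r m z κ c X := by
  have hp := h.two_le
  by_cases hX' : X ∈ language a (p - 1)
  · exact hnn X hX'
  refine backward_induction (n := p - 1) (by omega) h.length_le_pred_add_one
    (P := fun X => 0 ≤ potRev a r m z κ c X) ?_ X (by omega) hX hX'
  intro X hl hav _ ih
  have h1 := h.sum_weight_mul_potRev hs hav (by omega)
  rw [hd, add_zero] at h1
  refine nonneg_of_mul_nonneg_right (a := z) ?_ hz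
  rw [← h1]
  refine Finset.sum_nonneg fun x _ => ?_
  by_cases hx : Avoids a (x :: X)
  · refine mul_nonneg (weight_nonneg _) ?_
    by_cases hmem : (x :: X).dropLast ∈ language a (p - 1)
    · exact hnn _ hmem
    · exact ih x hx hmem
  · rw [weight, if_neg hx, zero_mul]

theorem IsSystem.defect_eq_zero (h : IsSystem a r m p)
    (hs : IsSolution (fun j => (a j).reverse) (fun i => (r i).reverse) m p z κ c)
    [Nonempty (language a (p - 1))] {v : language a (p - 1) → ℝ} (hv : ∀ X, 0 < v X)
    (hAv : (adjacency a r m p).mulVec v = z • v) : defect (α := α) m z κ c = 0 :=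
  const_eq_zero_of_vecMul hv hAv (h.vecMul_potRev_adjacency hs)

/-- `IsSystem.pot_sign` is applied to the reversed system, with the reversals of allowed words as
`S`. These need not be the allowed words of the reversed family, as one-sided allowedness is not
symmetric. -/
theorem IsSystem.potRev_sign (h : IsSystem a r m p)
    (hs : IsSolution (fun j => (a j).reverse) (fun i => (r i).reverse) m p z κ c)
    (hz : 0 < z) [Nonempty (language a (p - 1))] (hirr : (adjacency a r m p).IsIrreducible)
    {v : language a (p - 1) → ℝ} (hv : ∀ X, 0 < v X)
    (hAv : (adjacency a r m p).mulVec v = z • v) :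
    (κ = 0 → c = 0) ∧ (0 < κ → ∀ X ∈ language a (p - 1), 0 < potRev a r m z κ c X) := by
  have hp := h.two_le
  have hd := h.defect_eq_zero hs hv hAv
  have htri := eigenvector_trichotomy hirr.transpose hz hv
    (by rw [Matrix.vecMul_transpose, hAv])
    (w := fun X : language a (p - 1) => potRev a r m z κ c X) (by
      ext Y
      rw [Matrix.mulVec_transpose, h.vecMul_potRev_adjacency hs, hd, add_zero]
      rfl)
  have hback : ∀ {κ : ℝ} {c : Fin ℓ ⊕ Fin s → ℝ},
      IsSolution (fun j => (a j).reverse) (fun i => (r i).reverse) m p z κ c →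
      defect (α := α) m z κ c = 0 →
      (∀ X ∈ List.reverse ⁻¹' language a (p - 1),
        0 ≤ pot (fun j => (a j).reverse) (fun i => (r i).reverse) m z κ c X) →
      ∀ X : List α, Avoids (fun j => (a j).reverse) X → X.length + 1 = p →
        0 ≤ pot (fun j => (a j).reverse) (fun i => (r i).reverse) m z κ c X := by
    intro κ c hs hd hnn X hX hl
    have h1 := h.potRev_nonneg hs hz hd (fun Y hY => hnn Y.reverse (by simpa using hY))
      (X := X.reverse) (avoids_reverse_iff.1 (by simpa using hX)) (by simpa using hl)
    rwa [potRev, List.reverse_reverse] at h1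
  have hpot : ∀ X : List α, pot (fun j => (a j).reverse) (fun i => (r i).reverse) m z κ c X =
      potRev a r m z κ c X.reverse := fun X => by rw [potRev, List.reverse_reverse]
  obtain ⟨X₀, hX₀⟩ := ‹Nonempty (language a (p - 1))›
  refine (h.reverse.pot_sign hs hz hd (S := List.reverse ⁻¹' language a (p - 1))
    ⟨X₀.reverse, by simpa using hX₀⟩ ?_ ?_ (hback hs hd) ?_).imp_right
    fun h2 hκ X hX => h2 hκ X.reverse (by simpa using hX)
  · intro X hX
    refine ⟨avoids_reverse_iff.1 ?_, ?_⟩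
    · simpa using avoids_of_mem_language (Set.mem_preimage.1 hX)
    · have := hX.1
      rw [List.length_reverse] at this
      omega
  · refine htri.imp (fun h0 X hX => ?_) (Or.imp (fun h0 X hX => ?_) fun h0 X hX => ?_)
    · rw [hpot]
      exact congrFun h0 ⟨X.reverse, hX⟩
    · rw [hpot]
      exact h0 ⟨X.reverse, hX⟩
    · rw [hpot]
      exact h0 ⟨X.reverse, hX⟩
  · intro hle X hX hl
    have := hback hs.neg (by rw [defect_neg, hd, neg_zero])
      (fun X hX => by rw [pot_neg]; exact neg_nonneg.2 (hle X hX)) X hX hl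
    rw [pot_neg] at this
    exact neg_nonneg.1 this

theorem IsSystem.pot_pos (h : IsSystem a r m p) (hs : IsSolution a r m p z κ c) (hz : 0 < z)
    (hd : defect (α := α) m z κ c = 0) [Nonempty (language a (p - 1))]
    (hirr : (adjacency a r m p).IsIrreducible) {u : language a (p - 1) → ℝ} (hu : ∀ X, 0 < u X)
    (hAu : (adjacency a r m p).vecMul u = z • u) (hκ : 0 < κ) {X : List α}
    (hX : X ∈ language a (p - 1)) : 0 < pot a r m z κ c X := by
  have hp := h.two_le
  have htri := eigenvector_trichotomy hirr hz hu hAu (h.adjacency_mulVec_pot hs hz hd)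
  refine (h.pot_sign hs hz hd (S := language a (p - 1)) ⟨X, hX⟩ ?_ ?_ ?_ ?_).2 hκ X hX
  · intro X hX
    refine ⟨avoids_of_mem_language hX, ?_⟩
    have := hX.1
    omega
  · exact htri.imp (fun h0 X hX => congrFun h0 ⟨X, hX⟩)
      (Or.imp (fun h0 X hX => h0 ⟨X, hX⟩) fun h0 X hX => h0 ⟨X, hX⟩)
  · intro hle X hX hl
    by_cases hX' : X ∈ language a (p - 1)
    · exact hle X hX'
    · exact (h.pot_eq_zero_of_not_mem hs hz hd hX hl hX').ge
  · intro hle X hX hl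
    by_cases hX' : X ∈ language a (p - 1)
    · exact hle X hX'
    · exact (h.pot_eq_zero_of_not_mem hs hz hd hX hl hX').le

end Eigenvectors

/-! ### The matrices `P`, `Q` and the linear systems for the potentials. -/

section LinearSystems

variable {α : Type*} {s ℓ : ℕ} {a : Fin s → List α}
  {r : Fin ℓ → List α} {m : Fin ℓ → ℕ} {p : ℕ} {z κ : ℝ} {c : Fin ℓ ⊕ Fin s → ℝ}

theorem IsSystem.coef_ne_zero (h : IsSystem a r m p) (hz : 0 < z) (i : Fin ℓ ⊕ Fin s) :
    coef m z 1 i ≠ 0 := by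
  rcases i with i | j
  · have h2 : (2 : ℝ) ≤ m i := by exact_mod_cast h.mult i
    have h3 : (1 : ℝ) / m i < 1 := by
      rw [div_lt_one (by linarith)]
      linarith
    simp only [coef, Sum.elim_inl, Pi.one_apply, mul_one]
    exact (mul_pos hz (sub_pos.2 h3)).ne'
  · simp only [coef, Sum.elim_inr, Pi.one_apply, mul_one]
    exact neg_ne_zero.2 hz.ne'

theorem elim_reverse (i : Fin ℓ ⊕ Fin s) :
    Sum.elim (fun i => (r i).reverse) (fun j => (a j).reverse) i = (Sum.elim r a i).reverse := by
  rcases i with i | j <;> rfl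

theorem coef_eq_mul (m : Fin ℓ → ℕ) (z : ℝ) (c : Fin ℓ ⊕ Fin s → ℝ) (i : Fin ℓ ⊕ Fin s) :
    coef m z c i = coef m z 1 i * c i := by
  rcases i with i | j <;> simp [coef]

theorem matD_eq (m : Fin ℓ → ℕ) (z : ℝ) : matD s m z = Matrix.diagonal (coef m z 1) := by
  rw [matD]
  congr 1
  ext (i | j) <;> simp [coef]

theorem IsSystem.isUnit_det_matD (h : IsSystem a r m p) (hz : 0 < z) :
    IsUnit (matD s m z).det := by
  rw [matD_eq, Matrix.det_diagonal]
  exact (Finset.prod_ne_zero_iff.2 fun i _ => h.coef_ne_zero hz i).isUnit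

variable [DecidableEq α]

theorem IsSystem.matP_apply (h : IsSystem a r m p) (i j : Fin ℓ ⊕ Fin s) :
    matP a r m z i j = coef m z 1 j * correlation (Sum.elim r a j) (Sum.elim r a i) z -
      if i = j then Sum.elim (fun _ => z ^ p) (fun _ => 0) j else 0 := by
  rcases i with i | i <;> rcases j with j | j <;>
    simp [matP, coef, h.length_eq]

theorem IsSystem.matP_mulVec (h : IsSystem a r m p) (c : Fin ℓ ⊕ Fin s → ℝ)
    (i : Fin ℓ ⊕ Fin s) :
    (matP a r m z).mulVec c i =
      ∑ j, coef m z c j * correlation (Sum.elim r a j) (Sum.elim r a i) z -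
        Sum.elim (fun _ => z ^ p) (fun _ => 0) i * c i := by
  simp only [Matrix.mulVec, dotProduct, h.matP_apply, sub_mul, Finset.sum_sub_distrib, ite_mul,
    zero_mul, Finset.sum_ite_eq, Finset.mem_univ, if_true, coef_eq_mul m z c]
  congr 1
  exact Finset.sum_congr rfl fun j _ => by ring

theorem IsSystem.matP_transpose_mulVec (h : IsSystem a r m p) (c : Fin ℓ ⊕ Fin s → ℝ)
    (i : Fin ℓ ⊕ Fin s) :
    (matP a r m z).transpose.mulVec (coef m z c) i =
      coef m z 1 i * (∑ j, coef m z c j * correlation (Sum.elim r a i) (Sum.elim r a j) z -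
        Sum.elim (fun _ => z ^ p) (fun _ => 0) i * c i) := by
  simp only [Matrix.mulVec, dotProduct, Matrix.transpose_apply, h.matP_apply, sub_mul,
    Finset.sum_sub_distrib, ite_mul, zero_mul, Finset.sum_ite_eq', Finset.mem_univ, if_true]
  rw [mul_sub, Finset.mul_sum, coef_eq_mul m z c i]
  congr 1
  · exact Finset.sum_congr rfl fun j _ => by ring
  · ring

theorem IsSystem.correlation_reverse_words (h : IsSystem a r m p) (i j : Fin ℓ ⊕ Fin s) :
    correlation (Sum.elim r a j).reverse (Sum.elim r a i).reverse z =
      correlation (Sum.elim r a i) (Sum.elim r a j) z := by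
  refine correlation_reverse (fun h' => ?_) (fun h' => ?_) z
  · rw [h.reduced _ _ h']
  · rw [h.reduced _ _ h']

/-- The sum in row `i` is `κ` minus the potential of the `i`-th word. -/
theorem isSolution_iff : IsSolution a r m p z κ c ↔
    ∀ i, ∑ j, coef m z c j * correlation (Sum.elim r a i) (Sum.elim r a j) z -
      Sum.elim (fun _ => z ^ p) (fun _ => 0) i * c i = κ := by
  rw [Sum.forall, and_comm, IsSolution]
  refine and_congr (forall_congr' fun j => ?_) (forall_congr' fun i => ?_)
  · simp only [pot, potential, Sum.elim_inr, zero_mul, sub_zero]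
    rw [sub_eq_zero, eq_comm]
  · simp only [pot, potential, Sum.elim_inl]
    constructor <;> intro h <;> linarith

/-- A solution of the linear system with matrix `P(z)` is one for the reversed words. -/
theorem IsSystem.isSolution_reverse (h : IsSystem a r m p)
    (hP : ∀ i, (matP a r m z).mulVec c i = κ) :
    IsSolution (fun j => (a j).reverse) (fun i => (r i).reverse) m p z κ c := by
  rw [isSolution_iff]
  intro i
  simp only [elim_reverse, h.correlation_reverse_words]
  rw [← h.matP_mulVec, hP]

/-- The hypothesis is Q(z)c = κ1 multiplied by D(z); each row carries a nonzero factor `coef m z 1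
i`, which cancels. -/
theorem IsSystem.isSolution_of_transpose (h : IsSystem a r m p) (hz : 0 < z)
    (hQ : ∀ i, (matP a r m z).transpose.mulVec (coef m z c) i = κ * coef m z 1 i) :
    IsSolution a r m p z κ c := by
  rw [isSolution_iff]
  intro i
  have h1 := hQ i
  rw [h.matP_transpose_mulVec, mul_comm κ] at h1
  exact mul_left_cancel₀ (h.coef_ne_zero hz i) h1

theorem IsSystem.isUnit_det_matQ (h : IsSystem a r m p) (hz : 0 < z)
    (hP : IsUnit (matP a r m z).det) : IsUnit (matQ a r m z).det := by
  rw [matQ, Matrix.det_mul, Matrix.det_mul, Matrix.det_transpose]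
  exact ((Matrix.isUnit_nonsing_inv_det _ (h.isUnit_det_matD hz)).mul hP).mul
    (h.isUnit_det_matD hz)

theorem matP_mulVec_rowR (hP : IsUnit (matP a r m z).det) (i : Fin ℓ ⊕ Fin s) :
    (matP a r m z).mulVec (rowR a r m z) i = 1 := by
  have h1 : rowR a r m z = (matP a r m z)⁻¹.mulVec 1 := by
    ext i
    simp [rowR, Matrix.mulVec, dotProduct]
  rw [h1, Matrix.mulVec_mulVec, Matrix.mul_nonsing_inv _ hP, Matrix.one_mulVec, Pi.one_apply]

theorem IsSystem.transpose_mulVec_rowS (h : IsSystem a r m p) (hz : 0 < z)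
    (hP : IsUnit (matP a r m z).det) :
    (matP a r m z).transpose.mulVec (coef m z (rowS a r m z)) = coef m z 1 := by
  have h1 : rowS a r m z = (matQ a r m z)⁻¹.mulVec 1 := by
    ext i
    simp [rowS, Matrix.mulVec, dotProduct]
  have h2 : (matQ a r m z).mulVec (rowS a r m z) = 1 := by
    rw [h1, Matrix.mulVec_mulVec, Matrix.mul_nonsing_inv _ (h.isUnit_det_matQ hz hP),
      Matrix.one_mulVec]
  have h3 : ∀ c : Fin ℓ ⊕ Fin s → ℝ, (matD s m z).mulVec c = coef m z c := fun c => by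
    ext i
    rw [matD_eq, Matrix.mulVec_diagonal, ← coef_eq_mul]
  have h4 := congrArg (matD s m z).mulVec h2
  rwa [matQ, Matrix.mulVec_mulVec, Matrix.mul_assoc, ← Matrix.mul_assoc (matD s m z),
    Matrix.mul_nonsing_inv _ (h.isUnit_det_matD hz), Matrix.one_mul, ← Matrix.mulVec_mulVec,
    h3, h3] at h4

/-- Both sides equal 1ᵀ D P⁻¹ 1, since Q⁻¹ = D⁻¹ P⁻ᵀ D. So the two solutions have the same defect.
-/
theorem IsSystem.sum_coef_rowR_eq (h : IsSystem a r m p) (hz : 0 < z)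
    (hP : IsUnit (matP a r m z).det) :
    ∑ i, coef m z (rowR a r m z) i = ∑ i, coef m z (rowS a r m z) i := by
  have h1 : (matP a r m z).mulVec (rowR a r m z) = 1 := funext (matP_mulVec_rowR hP)
  have h2 : rowR a r m z ⬝ᵥ (matP a r m z).transpose.mulVec (coef m z (rowS a r m z)) =
      (matP a r m z).mulVec (rowR a r m z) ⬝ᵥ coef m z (rowS a r m z) := by
    rw [Matrix.dotProduct_mulVec, Matrix.vecMul_transpose]
  rw [h.transpose_mulVec_rowS hz hP, h1, one_dotProduct] at h2
  rw [← h2]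
  exact Finset.sum_congr rfl fun i _ => by rw [coef_eq_mul, mul_comm]

theorem vecV_eq_pot (X : List α) :
    vecV a r m z X = pot a r m z 1 (rowS a r m z) X := by
  simp only [vecV, pot, potential, coef, Fintype.sum_sum_type, Sum.elim_inl, Sum.elim_inr,
    Finset.mul_sum]
  simp only [neg_mul, Finset.sum_neg_distrib, mul_assoc]
  ring

theorem IsSystem.vecU_eq_potRev (h : IsSystem a r m p) {X : List α} (hX : Avoids a X)
    (hlen : X.length + 1 = p) :
    vecU a r m z X = potRev a r m z 1 (rowR a r m z) X := by
  have h1 : ∀ i, correlation (Sum.elim r a i).tail X z =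
      correlation X.reverse (Sum.elim r a i).reverse z := fun i =>
    correlation_tail_eq_reverse (by rw [hlen]; exact h.word_length_le i)
      (h.avoids_all hX (by omega) i) z
  have hr : ∀ i, correlation (r i).tail X z = correlation X.reverse (r i).reverse z :=
    fun i => h1 (Sum.inl i)
  have ha : ∀ j, correlation (a j).tail X z = correlation X.reverse (a j).reverse z :=
    fun j => h1 (Sum.inr j)
  simp only [vecU, potRev, pot, potential, coef, Fintype.sum_sum_type, Sum.elim_inl, Sum.elim_inr,
    Finset.mul_sum, hr, ha]
  simp only [neg_mul, Finset.sum_neg_distrib, mul_assoc]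
  ring

end LinearSystems

end RepeatedShift

/-! ### Assembly at the Perron root. -/

open RepeatedShift in
theorem mainTheorem8 {α : Type*} [Fintype α] [DecidableEq α] (hq : 2 ≤ Fintype.card α)
    {s ℓ : ℕ} (a : Fin s → List α) (r : Fin ℓ → List α) (m : Fin ℓ → ℕ) (p : ℕ)
    (ha_len : ∀ i, 2 ≤ (a i).length) (ha_red : IsReduced a)
    (h_symb : ∀ x : α, IsAllowed a [x])
    (hr_allowed : ∀ j, IsAllowed a (r j)) (hr_red : IsReduced r) (hm : ∀ j, 2 ≤ m j)
    (hp : IsGreatest (Set.range (fun i => (a i).length) ∪ Set.range (fun j => (r j).length)) p)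
    (hp_two : 2 ≤ p) (hr_len : ∀ j, (r j).length = p)
    (h_irr : (adjacency a r m p).IsIrreducible) :
    let A := adjacency a r m p
    let θ := perronRoot A
    let U : language a (p - 1) → ℝ := fun X => vecU a r m θ X
    let V : language a (p - 1) → ℝ := fun X => vecV a r m θ X
    IsUnit (matP a r m θ).det ∧ IsUnit (matQ a r m θ).det ∧
      (∀ X, 0 < U X) ∧ Matrix.vecMul U A = θ • U ∧
      (∀ X, 0 < V X) ∧ Matrix.mulVec A V = θ • V := by
  have hle : ∀ j, (a j).length ≤ p := fun j => hp.2 (Or.inl ⟨j, rfl⟩)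
  have h : IsSystem a r m p :=
    { two_le := hp_two
      ne_nil := fun j => List.length_pos_iff.1 (by have := ha_len j; omega)
      length_le := hle
      length_eq := hr_len
      mult := hm
      reduced := by
        rintro (i | i) (j | j) hij
        · by_contra hne
          exact hr_red i j (fun h' => hne (by rw [h'])) hij
        -- Since `r i` has the maximal length `p`, lying inside `a j` means equality, but an allowed
        -- word contains no forbidden one.
        · have h1 : r i = a j := hij.eq_of_length_le (by
            simp only [Sum.elim_inl, Sum.elim_inr, hr_len]
            exact hle j)
          exact absurd (h1 ▸ List.infix_rfl) (avoids_of_mem_language (hr_allowed i) j)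
        · exact absurd hij (avoids_of_mem_language (hr_allowed j) i)
        · by_contra hne
          exact ha_red i j (fun h' => hne (by rw [h'])) hij }
  have hne : Nonempty (language a (p - 1)) := by
    obtain ⟨x⟩ := Fintype.card_pos_iff.1 (show 0 < Fintype.card α by omega)
    obtain ⟨-, ξ, hξ, -⟩ := h_symb x
    exact ⟨⟨block ξ 0 (p - 1), length_block _ _ _, ξ, hξ, 0, rfl⟩⟩
  intro A θ U V
  obtain ⟨t, v, ht, hv, hAv⟩ := exists_pos_eigenvector h_irr
  have hθ : θ = t := perronRoot_eq_of_pos_eigenvector h_irr.nonneg ht.le hv hAv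
  rw [← hθ] at ht hAv
  have hP : IsUnit (matP a r m θ).det := by
    refine isUnit_iff_ne_zero.2 fun hdet => ?_
    obtain ⟨c, hc, hPc⟩ := Matrix.exists_mulVec_eq_zero_iff.2 hdet
    -- A kernel vector is a solution with constant 0, which the sign argument shows to be trivial.
    have hs := h.isSolution_reverse (κ := 0) (fun i => congrFun hPc i)
    exact hc ((h.potRev_sign hs ht h_irr hv hAv).1 rfl)
  have hsR := h.isSolution_reverse (matP_mulVec_rowR hP)
  have hdR := h.defect_eq_zero hsR hv hAv
  have hUeq : U = fun X : language a (p - 1) => potRev a r m θ 1 (rowR a r m θ) X := by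
    ext X
    have hlen := X.2.1
    exact h.vecU_eq_potRev (avoids_of_mem_language X.2) (by omega)
  have hUpos : ∀ X, 0 < U X := fun X => by
    rw [hUeq]
    exact (h.potRev_sign hsR ht h_irr hv hAv).2 one_pos X X.2
  have hU : Matrix.vecMul U A = θ • U := by
    ext Y
    rw [hUeq, h.vecMul_potRev_adjacency hsR, hdR, add_zero]
    rfl
  have hsS : IsSolution a r m p θ 1 (rowS a r m θ) := h.isSolution_of_transpose ht fun i => by
    rw [h.transpose_mulVec_rowS ht hP, one_mul]
  have hdS : defect (α := α) m θ 1 (rowS a r m θ) = 0 := by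
    rw [← hdR, defect, defect, h.sum_coef_rowR_eq ht hP]
  have hVeq : V = fun X : language a (p - 1) => pot a r m θ 1 (rowS a r m θ) X :=
    funext fun X => vecV_eq_pot _
  refine ⟨hP, h.isUnit_det_matQ ht hP, hUpos, hU, fun X => ?_, ?_⟩
  · rw [hVeq]
    exact h.pot_pos hsS ht hdS h_irr hUpos hU one_pos X.2
  · rw [hVeq]
    exact h.adjacency_mulVec_pot hsS ht hdS
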